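/- Let $m,n\ge 1$, let $D_1,D_2$ be diagonal $m\times m$ and $n\times n$ matrices with positive diagonal entries, let $U\subset\mathbb R^m$, $V\subset\mathbb R^n$, $I\subset\mathbb R$ be open and connected with $0\in V$, $0\in I$, let $H_1\colon U\times V\times I\to\mathbb R^m$, $G\colon U\times V\times I\to\mathbb R^n$, $H_2\colon U\times V\to\mathbb R^m$ be $C^2$ with $H_2(u,0)=0$, $G(u,0,\epsilon)=0$ for all $u\in U$, $\epsilon\in I$, and suppose that the symmetric part of $\partial_vG(u,0,0)$ is positive definite for every $u\in U$. Let $\epsilon_0>0$, $(0,\epsilon_0)\subset I$, and suppose that for every $\epsilon\in(0,\epsilon_0)$ there is given a $2L_\epsilon$-periodic solution ($L_\epsilon>0$) $\phi_\epsilon=(u_\epsilon,p_\epsilon,v_\epsilon,q_\epsilon)\colon\mathbb R\to U\times\mathbb R^m\times V\times\mathbb R^n$ of $$D_1u'=\epsilon p,\quad p'=\epsilon H_1(u,v,\epsilon)+H_2(u,v),\quad D_2v'=q,\quad q'=G(u,v,\epsilon),$$ such that: 1. $\epsilon L_\epsilon\to \check L_0>0$ as $\epsilon\downarrow0$. 2.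 There are $u_0\in U$, $p_0\in\mathbb R^m$ and a solution $(v_h,q_h)$ on $\mathbb R$, with $v_h\in V$, of $D_2v'=q$, $q'=G(u_0,v,0)$, homoclinic to $(0,0)$, with $\|\phi_\epsilon(0)-(u_0,p_0,v_h(0),q_h(0))\|=\mathcal O(\epsilon)$ as $\epsilon\downarrow 0$. 3. With $\mathcal M=\{(u,p,0,0):u\in U,\ p\in\mathbb R^m\}$, there are $L_s,\beta_s>0$ and a solution $(u_s,p_s)$ of $D_1u'=p$, $p'=H_1(u,0,0)$ with $u_s\in U$, defined on an open interval containing $[0,2\check L_0]$, such that for all sufficiently small $\epsilon>0$ and all $x\in[0,2L_\epsilon]$ $$d(\phi_\epsilon(x),\mathcal M)\le L_se^{-\beta_s\min\{x,2L_\epsilon-x\}},$$ $$\|\phi_\epsilon(x)-(u_s(\epsilon x),p_s(\epsilon x),0,0)\|\le L_s\max\{\epsilon,e^{-\beta_s\min\{x,2L_\epsilon-x\}}\}.$$ Put $\check u_\epsilon(\xi)=u_\epsilon(\xi/\epsilon)$, $\check v_\epsilon(\xi)=v_\epsilon(\xi/\epsilon)$ and let $$\mathcal L_\epsilon\begin{pmatrix}u\\v\end{pmatrix}=\begin{pmatrix}D_1\partial_{\xi\xi}u\\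 \epsilon^2D_2\partial_{\xi\xi}v\end{pmatrix}-\mathcal B_\epsilon(\xi)\begin{pmatrix}u\\v\end{pmatrix},\qquad \mathcal B_\epsilon=\begin{pmatrix}\partial_uH_1+\epsilon^{-1}\partial_uH_2&\partial_vH_1+\epsilon^{-1}\partial_vH_2\\ \partial_uG&\partial_vG\end{pmatrix},$$ with the derivatives of $H_1,G$ evaluated at $(\check u_\epsilon(\xi),\check v_\epsilon(\xi),\epsilon)$ and those of $H_2$ at $(\check u_\epsilon(\xi),\check v_\epsilon(\xi))$, be the linearization about this solution of $$\partial_tu=D_1\partial_{\xi\xi}u-H_1(u,v,\epsilon)-\epsilon^{-1}H_2(u,v),\qquad \partial_tv=\epsilon^2D_2\partial_{\xi\xi}v-G(u,v,\epsilon).$$ Here $C_{ub}$ is the space of bounded uniformly continuous functions with the supremum norm, and $C^2_{ub}$ the space of $C^2$ functions that are bounded and uniformly continuous together with their first two derivatives. Spectral notions for $\mathcal L_\epsilon$ refer to its complexification, and an operator $T$ is called sectorial if it is closed and there are $a\in\mathbb R$, $\theta\in(\pi/2,\pi)$, $M>0$ such that every $\lambda\ne a$ with $|\arg(\lambda-a)|<\theta$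 lies in the resolvent set and $\|(\lambda-T)^{-1}\|\le M/|\lambda-a|$. Then for every $\epsilon\in(0,\epsilon_0)$ the operator $\mathcal L_\epsilon$ is well defined on $C_{ub}^2(\mathbb R,\mathbb R^{m+n})\subset C_{ub}(\mathbb R,\mathbb R^{m+n})$ with values in $C_{ub}(\mathbb R,\mathbb R^{m+n})$, densely defined and sectorial. Moreover, there are $\omega>0$ and $\varpi\in(\pi/2,\pi)$, independent of $\epsilon$, such that for all sufficiently small $\epsilon>0$ the sector $$\{\lambda\in\mathbb C:\lambda\ne\omega,\ |\arg(\lambda-\omega)|\le\varpi\}\cup\{\omega\}$$ is contained in the resolvent set $\rho(\mathcal L_\epsilon)$. -/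

import Mathlib

open Set Filter Topology Matrix
open scoped BoundedContinuousFunction

namespace PulseSpectrum

/-! ### Spaces of bounded uniformly continuous functions -/

/-- The values of the perturbations: `𝕜^{m+n}`, with the components split as `(u, v)`.
It carries the maximum norm; all norms on this finite-dimensional space are equivalent, and every
notion below (density, closedness, resolvent set, sectoriality) is invariant under passing to an
equivalent norm. -/
abbrev Val (𝕜 : Type) (m n : ℕ) : Type := Fin m ⊕ Fin n → 𝕜

/-- Bounded and uniformly continuous functions on the real line. -/
def IsCub {E : Type} [NormedAddCommGroup E] (f : ℝ → E) : Prop :=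
  UniformContinuous f ∧ ∃ C : ℝ, ∀ x, ‖f x‖ ≤ C

section IsCub

variable {E : Type} [NormedAddCommGroup E]

theorem IsCub.add {f g : ℝ → E} (hf : IsCub f) (hg : IsCub g) : IsCub (f + g) := by
  obtain ⟨hf1, C, hC⟩ := hf
  obtain ⟨hg1, K, hK⟩ := hg
  exact ⟨hf1.add hg1, C + K, fun x => (norm_add_le _ _).trans (add_le_add (hC x) (hK x))⟩

theorem IsCub.zero : IsCub (0 : ℝ → E) :=
  ⟨uniformContinuous_const, 0, fun x => by simp⟩

theorem IsCub.smul {𝕜 : Type} [NormedField 𝕜] [NormedSpace 𝕜 E] (c : 𝕜) {f : ℝ → E}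
    (hf : IsCub f) : IsCub (c • f) := by
  obtain ⟨hf1, C, hC⟩ := hf
  refine ⟨hf1.const_smul c, ‖c‖ * C, fun x => ?_⟩
  rw [Pi.smul_apply, norm_smul]
  exact mul_le_mul_of_nonneg_left (hC x) (norm_nonneg c)

end IsCub

/-- The space `C_ub(ℝ, 𝕜^{m+n})` with the supremum norm. -/
def Cub (𝕜 : Type) [RCLike 𝕜] (m n : ℕ) : Submodule 𝕜 (ℝ →ᵇ Val 𝕜 m n) where
  carrier := {f | UniformContinuous f}
  add_mem' hf hg := UniformContinuous.add hf hg
  zero_mem' := uniformContinuous_const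
  smul_mem' c _ hf := UniformContinuous.const_smul hf c

/-- A bounded and uniformly continuous function as an element of `C_ub`. -/
noncomputable def toCub {𝕜 : Type} [RCLike 𝕜] {m n : ℕ} (f : ℝ → Val 𝕜 m n) (hf : IsCub f) : Cub 𝕜 m n :=
  ⟨BoundedContinuousFunction.ofNormedAddCommGroup f hf.1.continuous hf.2.choose
    hf.2.choose_spec, hf.1⟩

/-- `f ∈ C_ub^2`: `f` is twice continuously differentiable, and `f`, `f'`, `f''` are bounded and
uniformly continuous. -/
def IsC2ub {E : Type} [NormedAddCommGroup E] [NormedSpace ℝ E] (f : ℝ → E) : Prop :=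
  ContDiff ℝ 2 f ∧ ∀ i ≤ 2, IsCub (iteratedDeriv i f)

/-- The subspace `C_ub^2(ℝ, 𝕜^{m+n})` of `C_ub(ℝ, 𝕜^{m+n})`. -/
def C2ub (𝕜 : Type) [RCLike 𝕜] (m n : ℕ) : Submodule 𝕜 (Cub 𝕜 m n) where
  carrier := {f | IsC2ub (fun x => (f : ℝ →ᵇ Val 𝕜 m n) x)}
  add_mem' {f g} hf hg := by
    refine ⟨hf.1.add hg.1, fun i hi => ?_⟩
    have h2 : (i : WithTop ℕ∞) ≤ 2 := by exact_mod_cast hi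
    have : iteratedDeriv i (fun x => ((f + g : Cub 𝕜 m n) : ℝ →ᵇ Val 𝕜 m n) x) =
        iteratedDeriv i (fun x => (f : ℝ →ᵇ Val 𝕜 m n) x) +
          iteratedDeriv i (fun x => (g : ℝ →ᵇ Val 𝕜 m n) x) := by
      ext1 x
      exact iteratedDeriv_add (hf.1.contDiffAt.of_le h2) (hg.1.contDiffAt.of_le h2)
    rw [this]
    exact (hf.2 i hi).add (hg.2 i hi)
  zero_mem' := by
    refine ⟨contDiff_const, fun i _ => ?_⟩
    have : iteratedDeriv i (fun x => ((0 : Cub 𝕜 m n) : ℝ →ᵇ Val 𝕜 m n) x) = 0 := by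
      ext1 x
      simp
    rw [this]
    exact IsCub.zero
  smul_mem' c f hf := by
    refine ⟨hf.1.const_smul c, fun i hi => ?_⟩
    have h2 : (i : WithTop ℕ∞) ≤ 2 := by exact_mod_cast hi
    have : iteratedDeriv i (fun x => ((c • f : Cub 𝕜 m n) : ℝ →ᵇ Val 𝕜 m n) x) =
        c • iteratedDeriv i (fun x => (f : ℝ →ᵇ Val 𝕜 m n) x) := by
      ext1 x
      exact iteratedDeriv_const_smul (hf.1.contDiffAt.of_le h2) c
    rw [this]
    exact (hf.2 i hi).smul c

/-! ### Linear second order differential operators on `C_ub` -/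

/-- The differential expression `(D ∂² - B) f` with a diagonal diffusion matrix `D = diag δ` and a
real matrix-valued coefficient `B`. -/
noncomputable def diffExpr {𝕜 : Type} [RCLike 𝕜] {m n : ℕ} (δ : Fin m ⊕ Fin n → ℝ)
    (B : ℝ → Matrix (Fin m ⊕ Fin n) (Fin m ⊕ Fin n) ℝ) (f : ℝ → Val 𝕜 m n) :
    ℝ → Val 𝕜 m n := fun x =>
  (diagonal δ).map (algebraMap ℝ 𝕜) *ᵥ iteratedDeriv 2 f x -
    (B x).map (algebraMap ℝ 𝕜) *ᵥ f x

theorem diffExpr_add {𝕜 : Type} [RCLike 𝕜] {m n : ℕ} (δ : Fin m ⊕ Fin n → ℝ)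
    (B : ℝ → Matrix (Fin m ⊕ Fin n) (Fin m ⊕ Fin n) ℝ) {f g : Cub 𝕜 m n}
    (hf : f ∈ C2ub 𝕜 m n) (hg : g ∈ C2ub 𝕜 m n) :
    diffExpr δ B (f + g : Cub 𝕜 m n).1 = diffExpr δ B f.1 + diffExpr δ B g.1 := by
  ext1 x
  have : iteratedDeriv 2 (fun x => ((f + g : Cub 𝕜 m n) : ℝ →ᵇ Val 𝕜 m n) x) x =
      iteratedDeriv 2 (fun x => (f : ℝ →ᵇ Val 𝕜 m n) x) x +
        iteratedDeriv 2 (fun x => (g : ℝ →ᵇ Val 𝕜 m n) x) x :=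
    iteratedDeriv_add hf.1.contDiffAt hg.1.contDiffAt
  have h' : (f + g : Cub 𝕜 m n).1 x = f.1 x + g.1 x := rfl
  simp only [diffExpr, Pi.add_apply]
  rw [this, h', mulVec_add, mulVec_add]
  abel

theorem diffExpr_smul {𝕜 : Type} [RCLike 𝕜] {m n : ℕ} (δ : Fin m ⊕ Fin n → ℝ)
    (B : ℝ → Matrix (Fin m ⊕ Fin n) (Fin m ⊕ Fin n) ℝ) (c : 𝕜) {f : Cub 𝕜 m n}
    (hf : f ∈ C2ub 𝕜 m n) :
    diffExpr δ B (c • f : Cub 𝕜 m n).1 = c • diffExpr δ B f.1 := by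
  ext1 x
  have : iteratedDeriv 2 (fun x => ((c • f : Cub 𝕜 m n) : ℝ →ᵇ Val 𝕜 m n) x) x =
      c • iteratedDeriv 2 (fun x => (f : ℝ →ᵇ Val 𝕜 m n) x) x :=
    iteratedDeriv_const_smul hf.1.contDiffAt c
  have h' : (c • f : Cub 𝕜 m n).1 x = c • f.1 x := rfl
  simp only [diffExpr, Pi.smul_apply]
  rw [this, h', mulVec_smul, mulVec_smul, smul_sub]

/-- The operator `f ↦ D f'' - B f` in `C_ub(ℝ, 𝕜^{m+n})`. Its domain consists of all `f ∈ C_ub^2`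
for which the right-hand side lies in `C_ub`; this is all of `C_ub^2` when `B` is bounded and
uniformly continuous. For `𝕜 = ℂ` this is the complexification of the operator for `𝕜 = ℝ`. -/
noncomputable def diffOp (𝕜 : Type) [RCLike 𝕜] {m n : ℕ} (δ : Fin m ⊕ Fin n → ℝ)
    (B : ℝ → Matrix (Fin m ⊕ Fin n) (Fin m ⊕ Fin n) ℝ) :
    Cub 𝕜 m n →ₗ.[𝕜] Cub 𝕜 m n where
  domain :=
    { carrier := {f | f ∈ C2ub 𝕜 m n ∧ IsCub (diffExpr δ B f.1)}
      add_mem' := fun {f g} hf hg => ⟨add_mem hf.1 hg.1, by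
        rw [diffExpr_add δ B hf.1 hg.1]; exact hf.2.add hg.2⟩
      zero_mem' := ⟨zero_mem _, by
        have := diffExpr_smul (𝕜 := 𝕜) (m := m) (n := n) δ B 0 (zero_mem (C2ub 𝕜 m n))
        rw [zero_smul, zero_smul] at this
        rw [this]; exact IsCub.zero⟩
      smul_mem' := fun c f hf => ⟨Submodule.smul_mem _ c hf.1, by
        rw [diffExpr_smul δ B c hf.1]; exact hf.2.smul c⟩ }
  toFun :=
    { toFun := fun f => toCub (diffExpr δ B f.1.1) f.2.2
      map_add' := fun f g => Subtype.ext (DFunLike.ext _ _ fun x =>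
        congrFun (diffExpr_add δ B f.2.1 g.2.1) x)
      map_smul' := fun c f => Subtype.ext (DFunLike.ext _ _ fun x =>
        congrFun (diffExpr_smul δ B c f.2.1) x) }

/-! ### Resolvents and sectorial operators -/

/-- The bounded operator `R` is the inverse of `z - T : D(T) → X`. -/
def IsResolventAt {X : Type} [NormedAddCommGroup X] [NormedSpace ℂ X] (T : X →ₗ.[ℂ] X) (z : ℂ)
    (R : X →L[ℂ] X) : Prop :=
  (∀ y : X, ∃ h : R y ∈ T.domain, z • R y - T ⟨R y, h⟩ = y) ∧
    ∀ x : T.domain, R (z • (x : X) - T x) = x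

/-- The resolvent set of an unbounded operator. -/
def resolventSet {X : Type} [NormedAddCommGroup X] [NormedSpace ℂ X] (T : X →ₗ.[ℂ] X) : Set ℂ :=
  {z | ∃ R : X →L[ℂ] X, IsResolventAt T z R}

/-- A sectorial operator: `T` is closed, and for some `ω ∈ ℝ`, `θ ∈ (π/2, π)`, `M > 0` every
`z ≠ ω` with `|arg (z - ω)| < θ` is in the resolvent set and `‖(z - T)⁻¹‖ ≤ M / |z - ω|`. -/
def IsSectorial {X : Type} [NormedAddCommGroup X] [NormedSpace ℂ X] (T : X →ₗ.[ℂ] X) : Prop :=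
  T.IsClosed ∧ ∃ (ω θ M : ℝ), θ ∈ Ioo (Real.pi / 2) Real.pi ∧ 0 < M ∧
    ∀ z : ℂ, z ≠ ω → |Complex.arg (z - ω)| < θ →
      ∃ R : X →L[ℂ] X, IsResolventAt T z R ∧ ‖R‖ ≤ M / ‖z - ω‖

/-- The closed sector `{z ≠ ω : |arg (z - ω)| ≤ ϖ} ∪ {ω}`. -/
def sector (ω ϖ : ℝ) : Set ℂ :=
  {z : ℂ | z ≠ ω ∧ |Complex.arg (z - ω)| ≤ ϖ} ∪ {(ω : ℂ)}

/-! ### The reaction-diffusion system -/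

/-- The data of the system
`∂ₜ u = D₁ ∂² u - H₁(u,v,ε) - ε⁻¹ H₂(u,v)`, `∂ₜ v = ε² D₂ ∂² v - G(u,v,ε)`
with `u ∈ ℝ^m`, `v ∈ ℝ^n`, `D₁ = diag d₁`, `D₂ = diag d₂`. -/
structure RDSystem (m n : ℕ) where
  d₁ : Fin m → ℝ
  d₂ : Fin n → ℝ
  U : Set (Fin m → ℝ)
  V : Set (Fin n → ℝ)
  I : Set ℝ
  H₁ : (Fin m → ℝ) → (Fin n → ℝ) → ℝ → (Fin m → ℝ)
  H₂ : (Fin m → ℝ) → (Fin n → ℝ) → (Fin m → ℝ)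
  G : (Fin m → ℝ) → (Fin n → ℝ) → ℝ → (Fin n → ℝ)

/-- The Jacobian matrix of a map between coordinate spaces. -/
noncomputable def jacobian {k l : ℕ} (F : (Fin k → ℝ) → (Fin l → ℝ)) (w : Fin k → ℝ) :
    Matrix (Fin l) (Fin k) ℝ :=
  LinearMap.toMatrix' (fderiv ℝ F w : (Fin k → ℝ) →ₗ[ℝ] (Fin l → ℝ))

/-- Points `(u, p, v, q)` of the phase space of the stationary problem. -/
abbrev Phase (m n : ℕ) : Type := (Fin m → ℝ) × (Fin m → ℝ) × (Fin n → ℝ) × (Fin n → ℝ)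

namespace RDSystem

variable {m n : ℕ}

/-- Positive diffusion coefficients and the conditions on the interaction terms: `U`, `V`, `I` are
open and connected with `0 ∈ V`, `0 ∈ I`, the interaction terms are `C²`, and `H₂` and `G` vanish
at `v = 0`. -/
structure Interaction (S : RDSystem m n) : Prop where
  d₁_pos : ∀ i, 0 < S.d₁ i
  d₂_pos : ∀ i, 0 < S.d₂ i
  U_open : IsOpen S.U
  U_conn : IsConnected S.U
  V_open : IsOpen S.V
  V_conn : IsConnected S.V
  I_open : IsOpen S.I
  I_conn : IsConnected S.I
  zero_mem_V : (0 : Fin n → ℝ) ∈ S.V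
  zero_mem_I : (0 : ℝ) ∈ S.I
  H₁_smooth : ContDiffOn ℝ 2 (fun y : (Fin m → ℝ) × (Fin n → ℝ) × ℝ => S.H₁ y.1 y.2.1 y.2.2)
    (S.U ×ˢ S.V ×ˢ S.I)
  G_smooth : ContDiffOn ℝ 2 (fun y : (Fin m → ℝ) × (Fin n → ℝ) × ℝ => S.G y.1 y.2.1 y.2.2)
    (S.U ×ˢ S.V ×ˢ S.I)
  H₂_smooth : ContDiffOn ℝ 2 (fun y : (Fin m → ℝ) × (Fin n → ℝ) => S.H₂ y.1 y.2) (S.U ×ˢ S.V)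
  H₂_zero : ∀ u ∈ S.U, S.H₂ u 0 = 0
  G_zero : ∀ u ∈ S.U, ∀ ε ∈ S.I, S.G u 0 ε = 0

/-- Normal hyperbolicity: the symmetric part of `∂ᵥ G(u,0,0)` is positive definite for `u ∈ U`. -/
def NormallyHyperbolic (S : RDSystem m n) : Prop :=
  ∀ u ∈ S.U, ((1 / 2 : ℝ) • (jacobian (fun v => S.G u v 0) 0 +
    (jacobian (fun v => S.G u v 0) 0)ᵀ)).PosDef

/-- `ψ = (u, p, v, q)` is a solution on `ℝ`, with values in `U × ℝ^m × V × ℝ^n`, of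
`D₁ u' = ε p`, `p' = ε H₁(u,v,ε) + H₂(u,v)`, `D₂ v' = q`, `q' = G(u,v,ε)`. -/
structure IsStationary (S : RDSystem m n) (ε : ℝ) (u p : ℝ → Fin m → ℝ) (v q : ℝ → Fin n → ℝ) :
    Prop where
  mem_U : ∀ x, u x ∈ S.U
  mem_V : ∀ x, v x ∈ S.V
  u_eq : ∀ x, HasDerivAt (fun y => S.d₁ * u y) (ε • p x) x
  p_eq : ∀ x, HasDerivAt p (ε • S.H₁ (u x) (v x) ε + S.H₂ (u x) (v x)) x
  v_eq : ∀ x, HasDerivAt (fun y => S.d₂ * v y) (q x) x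
  q_eq : ∀ x, HasDerivAt q (S.G (u x) (v x) ε) x

/-- `(v, q)` is a solution on `ℝ`, with `v ∈ V`, of `D₂ v' = q`, `q' = G(u₀,v,0)`, tending to
`(0,0)` at `±∞`. (The zero solution is not excluded.) -/
structure IsHomoclinic (S : RDSystem m n) (u₀ : Fin m → ℝ) (v q : ℝ → Fin n → ℝ) : Prop where
  mem_V : ∀ x, v x ∈ S.V
  v_eq : ∀ x, HasDerivAt (fun y => S.d₂ * v y) (q x) x
  q_eq : ∀ x, HasDerivAt q (S.G u₀ (v x) 0) x
  tendsto_top : Tendsto (fun x => (v x, q x)) atTop (𝓝 0)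
  tendsto_bot : Tendsto (fun x => (v x, q x)) atBot (𝓝 0)

/-- `(u, p)` is a solution on `J`, with `u ∈ U`, of `D₁ u' = p`, `p' = H₁(u,0,0)`. -/
structure IsSlowSolution (S : RDSystem m n) (J : Set ℝ) (u p : ℝ → Fin m → ℝ) : Prop where
  mem_U : ∀ x ∈ J, u x ∈ S.U
  u_eq : ∀ x ∈ J, HasDerivAt (fun y => S.d₁ * u y) (p x) x
  p_eq : ∀ x ∈ J, HasDerivAt p (S.H₁ (u x) 0 0) x

/-- The manifold `M = {(u, p, 0, 0) : u ∈ U, p ∈ ℝ^m}`. -/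
def slowManifold (S : RDSystem m n) : Set (Phase m n) :=
  {y | y.1 ∈ S.U ∧ y.2.2.1 = 0 ∧ y.2.2.2 = 0}

/-- A family, indexed by `ε ∈ (0, ε₀)`, of `2 L_ε`-periodic pulse solutions
`(u_ε, p_ε, v_ε, q_ε)` of the stationary problem:
the rescaled half-period `ε L_ε` converges to `L₀ > 0`; at `x = 0` the solution is `O(ε)`-close to
a point of a homoclinic of the fast reduced system; and away from the pulse it is
exponentially close to `M` and close to a solution of the slow reduced system. The latter is only
required to exist on an open interval around `[0, 2 L₀]`. -/
structure IsPulseFamily (S : RDSystem m n) (ε₀ L₀ : ℝ) (L : ℝ → ℝ)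
    (u p : ℝ → ℝ → Fin m → ℝ) (v q : ℝ → ℝ → Fin n → ℝ) : Prop where
  subset_I : Ioo 0 ε₀ ⊆ S.I
  stationary : ∀ ε ∈ Ioo 0 ε₀, S.IsStationary ε (u ε) (p ε) (v ε) (q ε)
  L_pos : ∀ ε ∈ Ioo 0 ε₀, 0 < L ε
  periodic : ∀ ε ∈ Ioo 0 ε₀,
    Function.Periodic (fun x => ((u ε x, p ε x, v ε x, q ε x) : Phase m n)) (2 * L ε)
  L₀_pos : 0 < L₀
  order_period : Tendsto (fun ε => ε * L ε) (𝓝[>] 0) (𝓝 L₀)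
  pulse : ∃ u₀ ∈ S.U, ∃ (p₀ : Fin m → ℝ) (vh qh : ℝ → Fin n → ℝ), S.IsHomoclinic u₀ vh qh ∧
    (fun ε => ((u ε 0, p ε 0, v ε 0, q ε 0) : Phase m n) - (u₀, p₀, vh 0, qh 0))
      =O[𝓝[>] 0] (fun ε : ℝ => ε)
  decay : ∃ (Ls βs a b : ℝ) (us ps : ℝ → Fin m → ℝ), 0 < Ls ∧ 0 < βs ∧
    a < 0 ∧ 2 * L₀ < b ∧ S.IsSlowSolution (Ioo a b) us ps ∧
    ∀ᶠ ε in 𝓝[>] 0, ∀ x ∈ Icc 0 (2 * L ε),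
      Metric.infDist ((u ε x, p ε x, v ε x, q ε x) : Phase m n) S.slowManifold ≤
          Ls * Real.exp (-βs * min x (2 * L ε - x)) ∧
      ‖((u ε x, p ε x, v ε x, q ε x) : Phase m n) - (us (ε * x), ps (ε * x), 0, 0)‖ ≤
          Ls * max ε (Real.exp (-βs * min x (2 * L ε - x)))

/-- The matrix `𝓑_ε` of the linearized reaction terms at the point `(u, v)`. -/
noncomputable def reactionMatrix (S : RDSystem m n) (ε : ℝ) (u : Fin m → ℝ) (v : Fin n → ℝ) :
    Matrix (Fin m ⊕ Fin n) (Fin m ⊕ Fin n) ℝ :=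
  fromBlocks
    (jacobian (fun u' => S.H₁ u' v ε) u + ε⁻¹ • jacobian (fun u' => S.H₂ u' v) u)
    (jacobian (fun v' => S.H₁ u v' ε) v + ε⁻¹ • jacobian (fun v' => S.H₂ u v') v)
    (jacobian (fun u' => S.G u' v ε) u)
    (jacobian (fun v' => S.G u v' ε) v)

/-- The linearization of the reaction-diffusion system, in the large spatial scale `ξ = ε x`, about
the stationary solution whose `u`- and `v`-components in the small scale are `u x` and `v x`. -/
noncomputable def linearization (𝕜 : Type) [RCLike 𝕜] (S : RDSystem m n) (ε : ℝ)
    (u : ℝ → Fin m → ℝ) (v : ℝ → Fin n → ℝ) : Cub 𝕜 m n →ₗ.[𝕜] Cub 𝕜 m n :=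
  diffOp 𝕜 (Sum.elim S.d₁ (fun i => ε ^ 2 * S.d₂ i))
    (fun ξ => S.reactionMatrix ε (u (ε⁻¹ * ξ)) (v (ε⁻¹ * ξ)))

end RDSystem

end PulseSpectrum

namespace PulseSpectrum

/-! ### Resolvents of first and second derivatives on the real line -/

/-! The operator is `D ∂² - B`, with `D` constant diagonal and `B` continuous and periodic. Off a
sector around the negative axis, the resolvent `R₀` of `D ∂²` at `z` is, in each component,
convolution with `exp (-κ|x|) / (2κδ)`, where `δ κ² = z` and `Re κ > 0`. Since `z - D ∂² + B = (z -
D ∂²)(1 + R₀ B)`, everything reduces to inverting `1 + R₀ B`.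

For fixed `ε` this is a Neumann series: `‖R₀‖ ≤ 2/|z|` on the sector, so `‖R₀ B‖ ≤ 1/2` once `|z|`
is large, which also gives the sectorial estimate (`isSectorial_diffOp`). Density of `C_ub^2` comes
from averaging twice.

Uniformity in `ε` is the real issue, because `B` contains terms of size `ε⁻¹`. They are tamed by
localization. Let `w` be the periodic weight `exp (-(β/ε) dist(ξ, P ℤ))`, with `P = 2 ε L_ε`. As
`H₂` and `G` vanish at `v = 0`, their `u`-derivatives are `O(|v|) = O(w)`, so the blocks of `B` are
`O(1 + ε⁻¹ w)`, `O(ε⁻¹)`, `O(w)` and `O(1)`. Measure `u` in the supremum norm and `v` against the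
weight `w + ε`. Then `B` sends the unit ball to functions bounded by `N (1 + ε⁻¹ w)` and `N (w +
ε)`. The slow Green operator controls the first, because `ε⁻¹ w` has mass `O(1)` per period; the
fast one preserves the weight `w + ε`, because its kernel decays faster than `w`. For `|z|` beyond a
bound independent of `ε`, both gain a factor `1/2` (`norm_green_slow_le`, `norm_green_fast_le`), so
`R₀ B` is a contraction in an equivalent norm (`exists_sector_subset_resolventSet`).

The block bounds need `(u_ε, v_ε)` in one compact subset of `U × V`. Near the pulse this is
continuous dependence on the initial value and on `ε`, compared with the homoclinic; elsewhere it is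
closeness to the slow solution (`IsPulseFamily.exists_compact`). -/

/-- The solution `g` of `g' + κ g = f` that is bounded when `f` is bounded and `0 < Re κ`. -/
noncomputable def halfLineResolvent (κ : ℂ) (f : ℝ → ℂ) (x : ℝ) : ℂ :=
  ∫ s in Ioi (0 : ℝ), Complex.exp (-κ * s) * f (x - s)

/-- The solution `g` of `δ κ² g - δ g'' = f` that is bounded when `f` is bounded. -/
noncomputable def green (κ : ℂ) (δ : ℝ) (f : ℝ → ℂ) (x : ℝ) : ℂ :=
  (2 * κ * δ)⁻¹ * (halfLineResolvent κ f x + halfLineResolvent κ (fun y => f (-y)) (-x))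

section HalfLine

variable {κ : ℂ} {f g : ℝ → ℂ} {C : ℝ}

theorem norm_cexp_neg_mul (κ : ℂ) (s : ℝ) :
    ‖Complex.exp (-κ * s)‖ = Real.exp (-κ.re * s) := by
  rw [Complex.norm_exp]; simp

theorem integrableOn_cexp_mul (hκ : 0 < κ.re) (hf : Continuous f) (hC : ∀ x, ‖f x‖ ≤ C) (x : ℝ) :
    MeasureTheory.IntegrableOn (fun s : ℝ => Complex.exp (-κ * s) * f (x - s)) (Ioi 0) := by
  refine MeasureTheory.Integrable.mul_bdd (c := C) ?_ ?_ ?_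
  · exact integrableOn_exp_mul_complex_Ioi (a := -κ) (by simpa using hκ) 0
  · exact (hf.comp (by fun_prop)).aestronglyMeasurable
  · exact Eventually.of_forall fun s => hC _

theorem norm_halfLineResolvent_le (x : ℝ) {h : ℝ → ℝ} (hfh : ∀ y, ‖f y‖ ≤ h y)
    (hh : MeasureTheory.IntegrableOn (fun s : ℝ => Real.exp (-κ.re * s) * h (x - s)) (Ioi 0)) :
    ‖halfLineResolvent κ f x‖ ≤ ∫ s in Ioi (0 : ℝ), Real.exp (-κ.re * s) * h (x - s) := by
  refine MeasureTheory.norm_integral_le_of_norm_le hh (Eventually.of_forall fun s => ?_)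
  rw [norm_mul, norm_cexp_neg_mul]
  exact mul_le_mul_of_nonneg_left (hfh _) (Real.exp_pos _).le

theorem integral_exp_neg_mul_Ioi {a : ℝ} (ha : 0 < a) :
    ∫ s in Ioi (0 : ℝ), Real.exp (-a * s) = a⁻¹ := by
  rw [integral_exp_mul_Ioi (a := -a) (by linarith) 0]
  simp

/-- A weight growing at rate at most `μ < Re κ` is absorbed by the kernel, which keeps the decay
rate `Re κ - μ`. -/
theorem norm_halfLineResolvent_le_of_weight {ρ : ℝ → ℝ} {μ c : ℝ} (hμ : μ < κ.re)
    (hρ : ∀ x y, ρ y ≤ ρ x * Real.exp (μ * |x - y|)) (hc : 0 ≤ c)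
    (hf : ∀ y, ‖f y‖ ≤ c * ρ y) (x : ℝ) :
    ‖halfLineResolvent κ f x‖ ≤ c * ρ x * (κ.re - μ)⁻¹ := by
  have hd : 0 < κ.re - μ := by linarith
  rw [← integral_exp_neg_mul_Ioi hd, ← MeasureTheory.integral_const_mul]
  refine MeasureTheory.norm_integral_le_of_norm_le ?_ ?_
  · exact (integrableOn_exp_mul_Ioi (a := -(κ.re - μ)) (by linarith) 0).const_mul _
  · filter_upwards [MeasureTheory.ae_restrict_mem measurableSet_Ioi] with s hs
    have hs' : 0 < s := hs
    rw [norm_mul, norm_cexp_neg_mul]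
    have h1 := hρ x (x - s)
    rw [show |x - (x - s)| = s by rw [sub_sub_cancel, abs_of_pos hs']] at h1
    have h2 : ‖f (x - s)‖ ≤ c * (ρ x * Real.exp (μ * s)) :=
      (hf _).trans (mul_le_mul_of_nonneg_left h1 hc)
    calc Real.exp (-κ.re * s) * ‖f (x - s)‖
        ≤ Real.exp (-κ.re * s) * (c * (ρ x * Real.exp (μ * s))) :=
          mul_le_mul_of_nonneg_left h2 (Real.exp_pos _).le
      _ = c * ρ x * (Real.exp (-κ.re * s) * Real.exp (μ * s)) := by ring
      _ = c * ρ x * Real.exp (-(κ.re - μ) * s) := by rw [← Real.exp_add]; ring_nf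

/-- Substituting `y = x - s` moves `x` into the prefactor and the upper limit, so the integral can
be differentiated although `f` is only continuous. -/
theorem halfLineResolvent_eq (κ : ℂ) (f : ℝ → ℂ) (x : ℝ) :
    halfLineResolvent κ f x =
      Complex.exp (-κ * x) * ∫ y in Iic x, Complex.exp (κ * y) * f y := by
  have h1 : ∀ s : ℝ, (Ioi (0 : ℝ)).indicator (fun s : ℝ => Complex.exp (-κ * s) * f (x - s)) s =
      (fun y => (Iio x).indicator
        (fun y : ℝ => Complex.exp (-κ * x) * (Complex.exp (κ * y) * f y)) y) (x - s) := by
    intro s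
    by_cases hs : 0 < s
    · rw [indicator_of_mem (by exact hs)]
      simp only
      rw [indicator_of_mem (by simpa using hs), ← mul_assoc, ← Complex.exp_add]
      congr 2
      push_cast; ring
    · rw [indicator_of_notMem (by exact hs)]
      simp only
      rw [indicator_of_notMem (by simpa using hs)]
  rw [halfLineResolvent, ← MeasureTheory.integral_indicator measurableSet_Ioi,
    MeasureTheory.integral_congr_ae (Eventually.of_forall h1),
    MeasureTheory.integral_sub_left_eq_self (μ := MeasureTheory.volume)
      (fun y => (Iio x).indicator
        (fun y : ℝ => Complex.exp (-κ * x) * (Complex.exp (κ * y) * f y)) y) x,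
    MeasureTheory.integral_indicator measurableSet_Iio, MeasureTheory.integral_Iic_eq_integral_Iio,
    MeasureTheory.integral_const_mul]

theorem hasDerivAt_halfLineResolvent (hκ : 0 < κ.re) (hf : Continuous f) (hC : ∀ x, ‖f x‖ ≤ C)
    (x : ℝ) : HasDerivAt (halfLineResolvent κ f) (f x - κ * halfLineResolvent κ f x) x := by
  have hcont : Continuous fun y : ℝ => Complex.exp (κ * y) * f y := by fun_prop
  have hint : ∀ a : ℝ, MeasureTheory.IntegrableOn (fun y : ℝ => Complex.exp (κ * y) * f y)
      (Iic a) := fun a => by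
    refine MeasureTheory.Integrable.mul_bdd (c := C) ?_ hf.aestronglyMeasurable
      (Eventually.of_forall hC)
    exact integrableOn_exp_mul_complex_Iic hκ a
  have h1 : HasDerivAt (fun x : ℝ => ∫ y in Iic x, Complex.exp (κ * y) * f y)
      (Complex.exp (κ * x) * f x) x := by
    have h2 : (fun x : ℝ => ∫ y in Iic x, Complex.exp (κ * y) * f y) = fun x : ℝ =>
        (∫ y in Iic (0 : ℝ), Complex.exp (κ * y) * f y) +
          ∫ y in (0 : ℝ)..x, Complex.exp (κ * y) * f y := by
      ext1 x
      rw [← intervalIntegral.integral_Iic_sub_Iic (hint 0) (hint x)]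
      ring
    rw [h2]
    exact (hcont.integral_hasStrictDerivAt 0 x).hasDerivAt.const_add _
  have h2 : HasDerivAt (fun x : ℝ => Complex.exp (-κ * x)) (Complex.exp (-κ * x) * -κ) x := by
    have := ((hasDerivAt_id (x : ℂ)).const_mul (-κ)).cexp.comp_ofReal
    simpa using this
  have h3 := h2.mul h1
  have h4 : halfLineResolvent κ f =
      (fun x : ℝ => Complex.exp (-κ * x)) * fun x : ℝ => ∫ y in Iic x, Complex.exp (κ * y) * f y := by
    ext1 x; exact halfLineResolvent_eq κ f x
  rw [h4]
  refine h3.congr_deriv ?_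
  rw [← mul_assoc (Complex.exp (-κ * x)), ← Complex.exp_add]
  simp
  ring

theorem halfLineResolvent_add (hκ : 0 < κ.re) (hf : Continuous f) (hC : ∀ x, ‖f x‖ ≤ C)
    (hg : Continuous g) {K : ℝ} (hK : ∀ x, ‖g x‖ ≤ K) (x : ℝ) :
    halfLineResolvent κ (fun y => f y + g y) x =
      halfLineResolvent κ f x + halfLineResolvent κ g x := by
  rw [halfLineResolvent, halfLineResolvent, halfLineResolvent, ← MeasureTheory.integral_add
    (integrableOn_cexp_mul hκ hf hC x) (integrableOn_cexp_mul hκ hg hK x)]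
  simp only [mul_add]

theorem halfLineResolvent_const_mul (c : ℂ) (x : ℝ) :
    halfLineResolvent κ (fun y => c * f y) x = c * halfLineResolvent κ f x := by
  rw [halfLineResolvent, halfLineResolvent, ← MeasureTheory.integral_const_mul]
  congr 1
  ext1 s
  ring

theorem norm_halfLineResolvent_le_of_bound (hκ : 0 < κ.re) (hC : ∀ x, ‖f x‖ ≤ C) (x : ℝ) :
    ‖halfLineResolvent κ f x‖ ≤ C * κ.re⁻¹ := by
  have := norm_halfLineResolvent_le_of_weight (ρ := fun _ => 1) (μ := 0) (c := C) hκ (by simp)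
    ((norm_nonneg _).trans (hC 0)) (by simpa using hC) x
  simpa using this

end HalfLine

/-! ### The two-sided Green operator of `δ κ² - δ ∂²` -/

section Green

variable {κ : ℂ} {δ : ℝ} {f g : ℝ → ℂ} {C : ℝ}

theorem norm_green_le {x A B : ℝ} (hA : ‖halfLineResolvent κ f x‖ ≤ A)
    (hB : ‖halfLineResolvent κ (fun y => f (-y)) (-x)‖ ≤ B) :
    ‖green κ δ f x‖ ≤ (2 * ‖κ‖ * |δ|)⁻¹ * (A + B) := by
  rw [green, norm_mul, norm_inv, norm_mul, norm_mul]
  have : ‖(2 : ℂ)‖ = 2 := by simp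
  rw [this, Complex.norm_real, Real.norm_eq_abs]
  exact mul_le_mul_of_nonneg_left ((norm_add_le _ _).trans (add_le_add hA hB)) (by positivity)

theorem norm_green_le_of_bound (hκ : 0 < κ.re) (hC : ∀ x, ‖f x‖ ≤ C) (x : ℝ) :
    ‖green κ δ f x‖ ≤ (‖κ‖ * |δ| * κ.re)⁻¹ * C := by
  refine (norm_green_le (norm_halfLineResolvent_le_of_bound hκ hC x)
    (norm_halfLineResolvent_le_of_bound hκ (fun y => hC (-y)) (-x))).trans (le_of_eq ?_)
  rw [mul_inv, mul_inv, mul_inv, mul_inv]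
  ring

theorem norm_green_le_of_weight {ρ : ℝ → ℝ} {μ c : ℝ} (hμ : μ < κ.re)
    (hρ : ∀ x y, ρ y ≤ ρ x * Real.exp (μ * |x - y|)) (hc : 0 ≤ c)
    (hf : ∀ y, ‖f y‖ ≤ c * ρ y) (x : ℝ) :
    ‖green κ δ f x‖ ≤ (‖κ‖ * |δ| * (κ.re - μ))⁻¹ * (c * ρ x) := by
  refine (norm_green_le (norm_halfLineResolvent_le_of_weight hμ hρ hc hf x)
    (norm_halfLineResolvent_le_of_weight (ρ := fun y => ρ (-y)) hμ (fun x y => ?_) hc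
      (fun y => hf (-y)) (-x))).trans (le_of_eq ?_)
  · have := hρ (-x) (-y)
    rwa [show -x - -y = -(x - y) by ring, abs_neg] at this
  rw [mul_inv, mul_inv, mul_inv, mul_inv]
  simp only [neg_neg]
  ring

/-- The values of `f` produced by the two half-line integrals cancel; only half-line integrals
remain, and these can be differentiated once more. -/
theorem hasDerivAt_green (hκ : 0 < κ.re) (hδ : δ ≠ 0) (hf : Continuous f) (hC : ∀ x, ‖f x‖ ≤ C)
    (x : ℝ) : HasDerivAt (green κ δ f)
      ((2 * δ : ℂ)⁻¹ * (halfLineResolvent κ (fun y => f (-y)) (-x) - halfLineResolvent κ f x))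
      x := by
  have hκ0 : κ ≠ 0 := fun h => by simp [h] at hκ
  have hδ0 : (δ : ℂ) ≠ 0 := by exact_mod_cast hδ
  have h1 := hasDerivAt_halfLineResolvent hκ hf hC x
  have h2 := (hasDerivAt_halfLineResolvent hκ (f := fun y => f (-y)) (by fun_prop)
    (fun y => hC (-y)) (-x)).scomp x (hasDerivAt_neg x)
  have h3 := (h1.add h2).const_mul (2 * κ * δ)⁻¹
  refine h3.congr_deriv ?_
  simp
  field_simp

theorem hasDerivAt_green_deriv (hκ : 0 < κ.re) (hδ : δ ≠ 0) (hf : Continuous f)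
    (hC : ∀ x, ‖f x‖ ≤ C) (x : ℝ) :
    HasDerivAt (fun x => (2 * δ : ℂ)⁻¹ *
        (halfLineResolvent κ (fun y => f (-y)) (-x) - halfLineResolvent κ f x))
      (κ ^ 2 * green κ δ f x - (δ : ℂ)⁻¹ * f x) x := by
  have hκ0 : κ ≠ 0 := fun h => by simp [h] at hκ
  have hδ0 : (δ : ℂ) ≠ 0 := by exact_mod_cast hδ
  have h1 := hasDerivAt_halfLineResolvent hκ hf hC x
  have h2 := (hasDerivAt_halfLineResolvent hκ (f := fun y => f (-y)) (by fun_prop)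
    (fun y => hC (-y)) (-x)).scomp x (hasDerivAt_neg x)
  have h3 := (h2.sub h1).const_mul (2 * δ : ℂ)⁻¹
  refine h3.congr_deriv ?_
  simp [green]
  field_simp
  ring

/-- Bounded solutions of `h'' = κ² h` vanish when `0 < Re κ`. -/
theorem eq_zero_of_bounded {h h' : ℝ → ℂ} (hκ : 0 < κ.re) (h1 : ∀ x, HasDerivAt h (h' x) x)
    (h2 : ∀ x, HasDerivAt h' (κ ^ 2 * h x) x) {K : ℝ} (hC : ∀ x, ‖h x‖ ≤ C)
    (hK : ∀ x, ‖h' x‖ ≤ K) (x : ℝ) : h x = 0 := by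
  have hexp : ∀ (a : ℂ) (x : ℝ), HasDerivAt (fun x : ℝ => Complex.exp (a * x))
      (Complex.exp (a * x) * a) x := fun a x => by
    have := ((hasDerivAt_id (x : ℂ)).const_mul a).cexp.comp_ofReal
    simpa using this
  -- A solution of `k' = a k` is a multiple of `exp (a x)`; when `Re a ≠ 0` it is unbounded in one
  -- direction unless it vanishes.
  have first : ∀ (a : ℂ) (k : ℝ → ℂ) (M : ℝ), a.re ≠ 0 → (∀ x, HasDerivAt k (a * k x) x) →
      (∀ x, ‖k x‖ ≤ M) → ∀ x, k x = 0 := by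
    intro a k M ha hk hM x
    have hconst : ∀ x : ℝ, Complex.exp (-a * x) * k x = k 0 := by
      have hd : ∀ x : ℝ, HasDerivAt (fun x : ℝ => Complex.exp (-a * x) * k x) 0 x := fun x => by
        refine ((hexp (-a) x).mul (hk x)).congr_deriv ?_
        ring
      intro x
      have := is_const_of_deriv_eq_zero (fun x => (hd x).differentiableAt)
        (fun x => (hd x).deriv) x 0
      simpa using this
    have hk0 : k 0 = 0 := by
      by_contra hne
      have hpos : 0 < ‖k 0‖ := norm_pos_iff.2 hne
      have hle : ∀ x : ℝ, ‖k 0‖ ≤ Real.exp (-a.re * x) * M := fun x => by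
        rw [← hconst x, norm_mul, norm_cexp_neg_mul]
        exact mul_le_mul_of_nonneg_left (hM x) (Real.exp_pos _).le
      have hlim : Tendsto (fun t : ℝ => Real.exp (-a.re * (a.re * t)) * M) atTop (𝓝 (0 * M)) := by
        refine Tendsto.mul_const M (Real.tendsto_exp_atBot.comp ?_)
        have : ∀ t : ℝ, -a.re * (a.re * t) = -(a.re ^ 2) * t := fun t => by ring
        simp only [this]
        exact tendsto_id.const_mul_atTop_of_neg (by have := sq_pos_of_ne_zero ha; linarith)
      have := ge_of_tendsto' hlim (fun t => hle (a.re * t))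
      linarith
    have := hconst x
    rw [hk0] at this
    exact (mul_eq_zero.1 this).resolve_left (Complex.exp_ne_zero _)
  -- Factorization of `∂² - κ²`: the function `h' + κ h` solves `k' = κ k`, and once it vanishes `h`
  -- solves `h' = -κ h`.
  have hz : ∀ x, h' x + κ * h x = 0 := by
    refine first κ _ (K + ‖κ‖ * C) hκ.ne' (fun x => ?_) (fun x => ?_)
    · refine ((h2 x).add ((h1 x).const_mul κ)).congr_deriv ?_
      ring
    · refine (norm_add_le _ _).trans (add_le_add (hK x) ?_)
      rw [norm_mul]
      exact mul_le_mul_of_nonneg_left (hC x) (norm_nonneg _)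
  refine first (-κ) h C (by simpa using hκ.ne') (fun x => ?_) hC x
  have := h1 x
  rwa [eq_neg_of_add_eq_zero_left (hz x), ← neg_mul] at this

/-- `green` is a left inverse of `δ κ² - δ ∂²` on bounded functions with bounded derivatives. -/
theorem green_eq {h h' h'' : ℝ → ℂ} (hκ : 0 < κ.re) (hδ : δ ≠ 0)
    (h1 : ∀ x, HasDerivAt h (h' x) x) (h2 : ∀ x, HasDerivAt h' (h'' x) x) {K : ℝ}
    (hC : ∀ x, ‖h x‖ ≤ C) (hK : ∀ x, ‖h' x‖ ≤ K) {M : ℝ} (hM : ∀ x, ‖f x‖ ≤ M)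
    (hf : Continuous f) (heq : ∀ x, f x = δ * κ ^ 2 * h x - δ * h'' x) (x : ℝ) :
    green κ δ f x = h x := by
  have hδ0 : (δ : ℂ) ≠ 0 := by exact_mod_cast hδ
  have b1 := fun x => norm_green_le_of_bound (δ := δ) hκ hM x
  refine sub_eq_zero.1 (eq_zero_of_bounded (h := fun x => green κ δ f x - h x) hκ
    (fun x => (hasDerivAt_green hκ hδ hf hM x).sub (h1 x)) (fun x => ?_)
    (fun x => (norm_sub_le _ _).trans (add_le_add (b1 x) (hC x)))
    (K := ‖(2 * δ : ℂ)⁻¹‖ * (M * κ.re⁻¹ + M * κ.re⁻¹) + K) (fun x => ?_) x)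
  · refine ((hasDerivAt_green_deriv hκ hδ hf hM x).sub (h2 x)).congr_deriv ?_
    rw [heq x]
    field_simp
    ring
  · refine (norm_sub_le _ _).trans (add_le_add ?_ (hK x))
    rw [norm_mul]
    refine mul_le_mul_of_nonneg_left ((norm_sub_le _ _).trans (add_le_add ?_ ?_)) (norm_nonneg _)
    · exact norm_halfLineResolvent_le_of_bound hκ (fun y => hM (-y)) (-x)
    · exact norm_halfLineResolvent_le_of_bound hκ hM x

end Green

/-! ### Bounded uniformly continuous functions -/

section IsCubLemmas

variable {E : Type} [NormedAddCommGroup E]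

theorem IsCub.neg {f : ℝ → E} (hf : IsCub f) : IsCub (-f) := by
  obtain ⟨hf1, C, hC⟩ := hf
  exact ⟨hf1.neg, C, fun x => by simpa using hC x⟩

theorem IsCub.sub {f g : ℝ → E} (hf : IsCub f) (hg : IsCub g) : IsCub (f - g) := by
  rw [sub_eq_add_neg]
  exact hf.add hg.neg

theorem IsCub.sum {ι : Type} (s : Finset ι) {f : ι → ℝ → E} (hf : ∀ i ∈ s, IsCub (f i)) :
    IsCub (fun x => ∑ i ∈ s, f i x) := by
  classical
  induction s using Finset.induction_on with
  | empty => simpa using! IsCub.zero (E := E)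
  | insert a s ha ih =>
    have h1 : (fun x => ∑ i ∈ insert a s, f i x) = f a + fun x => ∑ i ∈ s, f i x := by
      ext1 x; rw [Finset.sum_insert ha]; rfl
    rw [h1]
    exact (hf a (Finset.mem_insert_self a s)).add
      (ih fun i hi => hf i (Finset.mem_insert_of_mem hi))

theorem IsCub.mul {R : Type} [NormedRing R] {f g : ℝ → R} (hf : IsCub f) (hg : IsCub g) :
    IsCub (fun x => f x * g x) := by
  obtain ⟨hf1, C, hC⟩ := hf
  obtain ⟨hg1, K, hK⟩ := hg
  have hC0 : 0 ≤ C := (norm_nonneg _).trans (hC 0)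
  have hK0 : 0 ≤ K := (norm_nonneg _).trans (hK 0)
  refine ⟨?_, C * K, fun x => (norm_mul_le _ _).trans
    (mul_le_mul (hC x) (hK x) (norm_nonneg _) hC0)⟩
  rw [Metric.uniformContinuous_iff] at hf1 hg1 ⊢
  intro e he
  obtain ⟨a, ha, h1⟩ := hf1 (e / (2 * (K + 1))) (by positivity)
  obtain ⟨b, hb, h2⟩ := hg1 (e / (2 * (C + 1))) (by positivity)
  refine ⟨min a b, lt_min ha hb, fun {x y} hxy => ?_⟩
  have h1' := h1 (hxy.trans_le (min_le_left _ _))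
  have h2' := h2 (hxy.trans_le (min_le_right _ _))
  rw [dist_eq_norm] at h1' h2' ⊢
  have h3 : f x * g x - f y * g y = f x * (g x - g y) + (f x - f y) * g y := by noncomm_ring
  rw [h3]
  have h4 : ‖f x * (g x - g y)‖ ≤ C * (e / (2 * (C + 1))) :=
    (norm_mul_le _ _).trans (mul_le_mul (hC x) h2'.le (norm_nonneg _) hC0)
  have h5 : ‖(f x - f y) * g y‖ ≤ e / (2 * (K + 1)) * K :=
    (norm_mul_le _ _).trans (mul_le_mul h1'.le (hK y) (norm_nonneg _) (by positivity))
  have h6 : C * (e / (2 * (C + 1))) < e / 2 := by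
    rw [mul_div_assoc', div_lt_div_iff₀ (by positivity) (by positivity)]; nlinarith
  have h7 : e / (2 * (K + 1)) * K < e / 2 := by
    rw [div_mul_eq_mul_div, div_lt_div_iff₀ (by positivity) (by positivity)]; nlinarith
  exact (norm_add_le _ _).trans_lt (by linarith)

theorem isCub_pi {ι : Type} [Fintype ι] {f : ℝ → ι → E} :
    IsCub f ↔ ∀ i, IsCub (fun x => f x i) := by
  refine ⟨fun ⟨h1, C, hC⟩ i => ⟨uniformContinuous_pi.1 h1 i, C, fun x =>
    (norm_le_pi_norm _ i).trans (hC x)⟩, fun h => ?_⟩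
  refine ⟨uniformContinuous_pi.2 fun i => (h i).1, ?_⟩
  choose C hC using fun i => (h i).2
  refine ⟨∑ i, |C i|, fun x => (pi_norm_le_iff_of_nonneg (by positivity)).2 fun i => ?_⟩
  exact ((hC i x).trans (le_abs_self _)).trans
    (Finset.single_le_sum (f := fun i => |C i|) (fun _ _ => abs_nonneg _) (Finset.mem_univ i))

theorem IsCub.ofReal (𝕜 : Type) [RCLike 𝕜] {f : ℝ → ℝ} (hf : IsCub f) :
    IsCub (fun x => algebraMap ℝ 𝕜 (f x)) := by
  obtain ⟨h1, C, hC⟩ := hf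
  refine ⟨(RCLike.lipschitzWith_ofReal (K := 𝕜)).uniformContinuous.comp h1, C, fun x => ?_⟩
  simpa using hC x

variable [NormedSpace ℝ E]

theorem isCub_of_hasDerivAt {f f' : ℝ → E} {C K : ℝ} (h : ∀ x, HasDerivAt f (f' x) x)
    (hC : ∀ x, ‖f x‖ ≤ C) (hK : ∀ x, ‖f' x‖ ≤ K) : IsCub f := by
  have hK0 : 0 ≤ K := (norm_nonneg _).trans (hK 0)
  refine ⟨(lipschitzWith_of_nnnorm_deriv_le (C := ⟨K, hK0⟩) (fun x => (h x).differentiableAt)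
    fun x => ?_).uniformContinuous, C, hC⟩
  rw [(h x).deriv]
  exact hK x

theorem iteratedDeriv_two_of_hasDerivAt {f f' f'' : ℝ → E} (h1 : ∀ x, HasDerivAt f (f' x) x)
    (h2 : ∀ x, HasDerivAt f' (f'' x) x) : iteratedDeriv 2 f = f'' := by
  have e1 : deriv f = f' := funext fun x => (h1 x).deriv
  have e2 : deriv f' = f'' := funext fun x => (h2 x).deriv
  rw [iteratedDeriv_succ, iteratedDeriv_one, e1, e2]

theorem isC2ub_of_hasDerivAt {f f' f'' : ℝ → E} (h1 : ∀ x, HasDerivAt f (f' x) x)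
    (h2 : ∀ x, HasDerivAt f' (f'' x) x) (hf : IsCub f) (hf' : IsCub f') (hf'' : IsCub f'') :
    IsC2ub f := by
  have e1 : deriv f = f' := funext fun x => (h1 x).deriv
  have e2 : deriv f' = f'' := funext fun x => (h2 x).deriv
  refine ⟨?_, fun i hi => ?_⟩
  · rw [show (2 : WithTop ℕ∞) = 1 + 1 by norm_num, contDiff_succ_iff_deriv]
    refine ⟨fun x => (h1 x).differentiableAt, by simp, ?_⟩
    rw [e1, contDiff_one_iff_deriv, e2]
    exact ⟨fun x => (h2 x).differentiableAt, hf''.1.continuous⟩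
  · interval_cases i
    · rwa [iteratedDeriv_zero]
    · rwa [iteratedDeriv_one, e1]
    · rwa [iteratedDeriv_two_of_hasDerivAt h1 h2]

theorem IsC2ub.hasDerivAt {f : ℝ → E} (hf : IsC2ub f) (x : ℝ) :
    HasDerivAt f (iteratedDeriv 1 f x) x := by
  rw [iteratedDeriv_one]
  exact (hf.1.differentiable (by simp)).differentiableAt.hasDerivAt

theorem IsC2ub.hasDerivAt_deriv {f : ℝ → E} (hf : IsC2ub f) (x : ℝ) :
    HasDerivAt (iteratedDeriv 1 f) (iteratedDeriv 2 f x) x := by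
  rw [iteratedDeriv_succ (n := 1)]
  exact (hf.1.differentiable_iteratedDeriv 1 (by norm_num)).differentiableAt.hasDerivAt

end IsCubLemmas

/-! ### `C_ub` as a Banach space and multiplication operators on it -/

section CubLemmas

variable {𝕜 : Type} [RCLike 𝕜] {m n : ℕ}

theorem isCub_coe (f : Cub 𝕜 m n) : IsCub f.1 :=
  ⟨f.2, ‖f.1‖, fun x => f.1.norm_coe_le_norm x⟩

theorem Cub.norm_le {f : Cub 𝕜 m n} {C : ℝ} (hC : 0 ≤ C) :
    ‖f‖ ≤ C ↔ ∀ x i, ‖f.1 x i‖ ≤ C := by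
  change ‖f.1‖ ≤ C ↔ _
  rw [BoundedContinuousFunction.norm_le hC]
  exact forall_congr' fun x => pi_norm_le_iff_of_nonneg hC

theorem Cub.norm_apply_le (f : Cub 𝕜 m n) (x : ℝ) (i : Fin m ⊕ Fin n) : ‖f.1 x i‖ ≤ ‖f‖ :=
  (Cub.norm_le (norm_nonneg f)).1 le_rfl x i

theorem Cub.ext' {f g : Cub 𝕜 m n} (h : ∀ x i, f.1 x i = g.1 x i) : f = g :=
  Subtype.ext (DFunLike.ext _ _ fun x => funext (h x))

/-- Uniform limits preserve uniform continuity. Completeness is what the Neumann series requires. -/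
instance : CompleteSpace (Cub 𝕜 m n) := by
  have : IsClosed (Cub 𝕜 m n : Set (ℝ →ᵇ Val 𝕜 m n)) := by
    refine IsSeqClosed.isClosed fun f g hf hg => ?_
    exact (BoundedContinuousFunction.tendsto_iff_tendstoUniformly.1 hg).uniformContinuous
      (Frequently.of_forall hf)
  exact this.completeSpace_coe

theorem isCub_mulVec {B : ℝ → Matrix (Fin m ⊕ Fin n) (Fin m ⊕ Fin n) ℝ}
    (hB : ∀ i j, IsCub fun x => B x i j) {f : ℝ → Val 𝕜 m n} (hf : IsCub f) :
    IsCub (fun x => (B x).map (algebraMap ℝ 𝕜) *ᵥ f x) :=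
  isCub_pi.2 fun i => IsCub.sum Finset.univ (f := fun j x => algebraMap ℝ 𝕜 (B x i j) * f x j)
    fun j _ => ((hB i j).ofReal 𝕜).mul (isCub_pi.1 hf j)

theorem isCub_diffExpr {δ : Fin m ⊕ Fin n → ℝ}
    {B : ℝ → Matrix (Fin m ⊕ Fin n) (Fin m ⊕ Fin n) ℝ} (hB : ∀ i j, IsCub fun x => B x i j)
    {f : ℝ → Val 𝕜 m n} (hf : IsC2ub f) : IsCub (diffExpr δ B f) := by
  have h0 : IsCub f := by simpa using hf.2 0 (by norm_num)
  refine IsCub.sub (isCub_mulVec (B := fun _ => diagonal δ) (fun i j => ?_) (hf.2 2 le_rfl))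
    (isCub_mulVec hB h0)
  exact ⟨uniformContinuous_const, _, fun _ => le_rfl⟩

theorem diffExpr_apply (δ : Fin m ⊕ Fin n → ℝ)
    (B : ℝ → Matrix (Fin m ⊕ Fin n) (Fin m ⊕ Fin n) ℝ) (f : ℝ → Val 𝕜 m n) (x : ℝ)
    (i : Fin m ⊕ Fin n) :
    diffExpr δ B f x i = algebraMap ℝ 𝕜 (δ i) * iteratedDeriv 2 f x i -
      ((B x).map (algebraMap ℝ 𝕜) *ᵥ f x) i := by
  rw [diffExpr, Pi.sub_apply, diagonal_map (map_zero _), mulVec_diagonal]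

theorem diffOp_domain (δ : Fin m ⊕ Fin n → ℝ)
    {B : ℝ → Matrix (Fin m ⊕ Fin n) (Fin m ⊕ Fin n) ℝ} (hB : ∀ i j, IsCub fun x => B x i j) :
    (diffOp 𝕜 δ B).domain = C2ub 𝕜 m n :=
  Submodule.ext fun _ => ⟨fun h => h.1, fun h => ⟨h, isCub_diffExpr hB h⟩⟩

/-- Bounded operators, for the structure underlying the norm. -/
abbrev BddOp (𝕜 : Type) [RCLike 𝕜] (X : Type) [NormedAddCommGroup X] [NormedSpace 𝕜 X] : Type :=
  X →L[𝕜] X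

/-- Multiplication by a real matrix-valued function with entries in `C_ub`. -/
noncomputable def mulOp (𝕜 : Type) [RCLike 𝕜]
    {B : ℝ → Matrix (Fin m ⊕ Fin n) (Fin m ⊕ Fin n) ℝ} (hB : ∀ i j, IsCub fun x => B x i j)
    (K : ℝ) (hK : ∀ x i j, |B x i j| ≤ K) : BddOp 𝕜 (Cub 𝕜 m n) :=
  LinearMap.mkContinuous
    { toFun := fun f => toCub _ (isCub_mulVec (𝕜 := 𝕜) hB (isCub_coe f))
      map_add' := fun f g => Subtype.ext (DFunLike.ext _ _ fun x =>
        mulVec_add ((B x).map (algebraMap ℝ 𝕜)) (f.1 x) (g.1 x))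
      map_smul' := fun c f => Subtype.ext (DFunLike.ext _ _ fun x =>
        mulVec_smul ((B x).map (algebraMap ℝ 𝕜)) c (f.1 x)) }
    ((m + n : ℕ) * K) fun f => by
      -- `K` is known to be nonnegative only through an entry of `B`, so the empty index type is
      -- treated apart.
      have hK0 : 0 ≤ (m + n : ℕ) * K * ‖f‖ := by
        rcases Nat.eq_zero_or_pos (m + n) with h | h
        · simp [h]
        · have : Nonempty (Fin m ⊕ Fin n) := by
            rw [← Fintype.card_pos_iff]; simpa using h
          have i : Fin m ⊕ Fin n := Classical.arbitrary _
          have := (abs_nonneg _).trans (hK 0 i i)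
          positivity
      refine (Cub.norm_le hK0).2 fun x i => ?_
      change ‖∑ j, algebraMap ℝ 𝕜 (B x i j) * f.1 x j‖ ≤ _
      refine (norm_sum_le _ _).trans ?_
      have h1 : ∀ j ∈ Finset.univ, ‖algebraMap ℝ 𝕜 (B x i j) * f.1 x j‖ ≤ K * ‖f‖ := fun j _ => by
        rw [norm_mul, norm_algebraMap']
        exact mul_le_mul (hK x i j) (Cub.norm_apply_le f x j) (norm_nonneg _)
          ((abs_nonneg _).trans (hK x i j))
      refine (Finset.sum_le_card_nsmul _ _ _ h1).trans (le_of_eq ?_)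
      simp
      ring

theorem norm_mulOp_le {B : ℝ → Matrix (Fin m ⊕ Fin n) (Fin m ⊕ Fin n) ℝ}
    (hB : ∀ i j, IsCub fun x => B x i j) {K : ℝ} (hK0 : 0 ≤ K) (hK : ∀ x i j, |B x i j| ≤ K) :
    ‖mulOp 𝕜 hB K hK‖ ≤ (m + n : ℕ) * K :=
  LinearMap.mkContinuous_norm_le _ (by positivity) _

end CubLemmas

/-! ### Density of `C_ub^2` -/

section Density

variable {E : Type} [NormedAddCommGroup E] [NormedSpace ℝ E] [CompleteSpace E]

/-- The Steklov average of `f` over the intervals `[x, x + h]`. -/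
noncomputable def steklov (h : ℝ) (f : ℝ → E) (x : ℝ) : E := h⁻¹ • ∫ s in x..(x + h), f s

theorem hasDerivAt_steklov {h : ℝ} {f : ℝ → E} (hf : Continuous f) (x : ℝ) :
    HasDerivAt (steklov h f) (h⁻¹ • (f (x + h) - f x)) x := by
  have h1 : steklov h f = fun x =>
      h⁻¹ • ((∫ s in (0 : ℝ)..(x + h), f s) - ∫ s in (0 : ℝ)..x, f s) := by
    ext1 x
    rw [steklov, intervalIntegral.integral_interval_sub_left (hf.intervalIntegrable _ _)
      (hf.intervalIntegrable _ _)]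
  rw [h1]
  have h2 := (hf.integral_hasStrictDerivAt 0 (x + h)).hasDerivAt.comp_add_const x h
  exact (h2.sub (hf.integral_hasStrictDerivAt 0 x).hasDerivAt).const_smul h⁻¹

theorem norm_steklov_sub_le {h e : ℝ} (hh : 0 < h) {f : ℝ → E} (hf : Continuous f) (x : ℝ)
    (he : ∀ s ∈ Icc x (x + h), ‖f s - f x‖ ≤ e) : ‖steklov h f x - f x‖ ≤ e := by
  have h1 : steklov h f x - f x = h⁻¹ • ∫ s in x..(x + h), (f s - f x) := by
    rw [intervalIntegral.integral_sub (hf.intervalIntegrable _ _)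
      (continuous_const.intervalIntegrable _ _), intervalIntegral.integral_const, steklov,
      smul_sub, smul_smul, add_sub_cancel_left, inv_mul_cancel₀ hh.ne', one_smul]
  rw [h1, norm_smul, norm_inv, Real.norm_of_nonneg hh.le]
  have h2 := intervalIntegral.norm_integral_le_of_norm_le_const (a := x) (b := x + h) (C := e)
    (f := fun s => f s - f x) (fun s hs => he s (by
      rw [uIoc_of_le (by linarith)] at hs; exact ⟨hs.1.le, hs.2⟩))
  rw [add_sub_cancel_left, abs_of_pos hh] at h2
  rw [inv_mul_le_iff₀ hh]
  linarith

omit [NormedSpace ℝ E] [CompleteSpace E] in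
theorem IsCub.comp_add_const {f : ℝ → E} (hf : IsCub f) (h : ℝ) : IsCub (fun x => f (x + h)) :=
  ⟨hf.1.comp (uniformContinuous_id.add_const h), hf.2.imp fun _ hC _ => hC _⟩

theorem isCub_steklov {h : ℝ} (hh : 0 < h) {f : ℝ → E} (hf : IsCub f) : IsCub (steklov h f) := by
  obtain ⟨C, hC⟩ := hf.2
  refine isCub_of_hasDerivAt (hasDerivAt_steklov hf.1.continuous) (C := h⁻¹ * (C * h))
    (K := h⁻¹ * (C + C)) (fun x => ?_) (fun x => ?_)
  · rw [steklov, norm_smul, norm_inv, Real.norm_of_nonneg hh.le]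
    have := intervalIntegral.norm_integral_le_of_norm_le_const (a := x) (b := x + h) (C := C)
      (f := f) (fun s _ => hC s)
    rw [add_sub_cancel_left, abs_of_pos hh] at this
    exact mul_le_mul_of_nonneg_left this (by positivity)
  · rw [norm_smul, norm_inv, Real.norm_of_nonneg hh.le]
    exact mul_le_mul_of_nonneg_left ((norm_sub_le _ _).trans (add_le_add (hC _) (hC _)))
      (by positivity)

/-- Each average gains one derivative, expressed by difference quotients of the function averaged;
two averages therefore reach `C_ub^2`. -/
theorem isC2ub_steklov_steklov {h : ℝ} (hh : 0 < h) {f : ℝ → E} (hf : IsCub f) :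
    IsC2ub (steklov h (steklov h f)) := by
  have hs := isCub_steklov hh hf
  refine isC2ub_of_hasDerivAt (hasDerivAt_steklov hs.1.continuous) (fun x =>
    (((hasDerivAt_steklov hf.1.continuous (x + h)).comp_add_const x h).sub
      (hasDerivAt_steklov hf.1.continuous x)).const_smul h⁻¹) (isCub_steklov hh hs) ?_ ?_
  · exact ((hs.comp_add_const h).sub hs).smul h⁻¹
  · have h1 := ((hf.comp_add_const h).sub hf).smul h⁻¹
    exact ((h1.comp_add_const h).sub h1).smul h⁻¹

theorem dense_C2ub (𝕜 : Type) [RCLike 𝕜] (m n : ℕ) : Dense (C2ub 𝕜 m n : Set (Cub 𝕜 m n)) := by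
  refine Metric.dense_iff.2 fun f r hr => ?_
  obtain ⟨d, hd, hfd⟩ := Metric.uniformContinuous_iff.1 (isCub_coe f).1 (r / 3) (by positivity)
  -- Any positive step below the modulus `d` would do.
  set h := d / 3 with hh
  have hh0 : 0 < h := by positivity
  have hs := isCub_steklov hh0 (isCub_coe f)
  have h1 : ∀ x, ‖steklov h f.1 x - f.1 x‖ ≤ r / 3 := fun x =>
    norm_steklov_sub_le hh0 (isCub_coe f).1.continuous x fun s hs => by
      rw [← dist_eq_norm]
      refine (hfd ?_).le
      rw [Real.dist_eq, abs_of_nonneg (by linarith [hs.1])]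
      linarith [hs.2]
  -- Averaging is linear and does not increase the supremum norm, so the second average costs no
  -- more than the first.
  have h2 : ∀ x, ‖steklov h (steklov h f.1) x - steklov h f.1 x‖ ≤ r / 3 := fun x => by
    have h3 : steklov h (steklov h f.1) x - steklov h f.1 x =
        steklov h (fun s => steklov h f.1 s - f.1 s) x := by
      rw [steklov, steklov, steklov, intervalIntegral.integral_sub
        (hs.1.continuous.intervalIntegrable _ _)
        ((isCub_coe f).1.continuous.intervalIntegrable _ _), smul_sub]
    rw [h3, steklov, norm_smul, norm_inv, Real.norm_of_nonneg hh0.le, inv_mul_le_iff₀ hh0]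
    have h4 := intervalIntegral.norm_integral_le_of_norm_le_const (a := x) (b := x + h)
      (C := r / 3) (f := fun s => steklov h f.1 s - f.1 s) (fun s _ => h1 s)
    rw [add_sub_cancel_left, abs_of_pos hh0] at h4
    linarith
  have hC2 := isC2ub_steklov_steklov hh0 (isCub_coe f)
  refine ⟨toCub _ (isCub_steklov hh0 hs), ?_, hC2⟩
  refine lt_of_le_of_lt ((dist_eq_norm (toCub _ (isCub_steklov hh0 hs)) f).trans_le <|
    (Cub.norm_le (C := 2 * (r / 3)) (by positivity)).2 fun x i => ?_)
    (by linarith)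
  change ‖(steklov h (steklov h f.1) x - f.1 x) i‖ ≤ _
  refine (norm_le_pi_norm _ i).trans ?_
  calc ‖steklov h (steklov h f.1) x - f.1 x‖
      ≤ ‖steklov h (steklov h f.1) x - steklov h f.1 x‖ + ‖steklov h f.1 x - f.1 x‖ :=
        norm_sub_le_norm_sub_add_norm_sub _ _ _
    _ ≤ 2 * (r / 3) := by linarith [h1 x, h2 x]

end Density

/-! ### The resolvent of a diagonal diffusion operator -/

section GreenOp

variable {m n : ℕ}

/-- The componentwise solution of `δ κ² g - δ g'' = f`. -/
noncomputable def greenFun (κ : Fin m ⊕ Fin n → ℂ) (δ : Fin m ⊕ Fin n → ℝ) (f : ℝ → Val ℂ m n) :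
    ℝ → Val ℂ m n := fun x i => green (κ i) (δ i) (fun y => f y i) x

variable {κ : Fin m ⊕ Fin n → ℂ} {δ : Fin m ⊕ Fin n → ℝ} {f : ℝ → Val ℂ m n}

/-- The derivative of `greenFun`. -/
noncomputable def greenFunDeriv (κ : Fin m ⊕ Fin n → ℂ) (δ : Fin m ⊕ Fin n → ℝ)
    (f : ℝ → Val ℂ m n) : ℝ → Val ℂ m n := fun x i =>
  (2 * δ i : ℂ)⁻¹ * (halfLineResolvent (κ i) (fun y => f (-y) i) (-x) -
    halfLineResolvent (κ i) (fun y => f y i) x)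

theorem hasDerivAt_greenFun (hκ : ∀ i, 0 < (κ i).re) (hδ : ∀ i, δ i ≠ 0) (hf : IsCub f) (x : ℝ) :
    HasDerivAt (greenFun κ δ f) (greenFunDeriv κ δ f x) x := by
  refine hasDerivAt_pi.2 fun i => ?_
  obtain ⟨h1, C, hC⟩ := isCub_pi.1 hf i
  exact hasDerivAt_green (hκ i) (hδ i) h1.continuous hC x

theorem hasDerivAt_greenFunDeriv (hκ : ∀ i, 0 < (κ i).re) (hδ : ∀ i, δ i ≠ 0) (hf : IsCub f)
    (x : ℝ) : HasDerivAt (greenFunDeriv κ δ f)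
      (fun i => κ i ^ 2 * greenFun κ δ f x i - (δ i : ℂ)⁻¹ * f x i) x := by
  refine hasDerivAt_pi.2 fun i => ?_
  obtain ⟨h1, C, hC⟩ := isCub_pi.1 hf i
  exact hasDerivAt_green_deriv (hκ i) (hδ i) h1.continuous hC x

theorem isCub_greenFun (hκ : ∀ i, 0 < (κ i).re) (hδ : ∀ i, δ i ≠ 0) (hf : IsCub f) :
    IsCub (greenFun κ δ f) := by
  refine isCub_pi.2 fun i => ?_
  obtain ⟨h1, C, hC⟩ := isCub_pi.1 hf i
  refine isCub_of_hasDerivAt (fun x => hasDerivAt_green (hκ i) (hδ i) h1.continuous hC x)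
    (fun x => norm_green_le_of_bound (hκ i) hC x)
    (K := ‖(2 * δ i : ℂ)⁻¹‖ * (C * (κ i).re⁻¹ + C * (κ i).re⁻¹)) (fun x => ?_)
  rw [norm_mul]
  refine mul_le_mul_of_nonneg_left ((norm_sub_le _ _).trans (add_le_add ?_ ?_)) (norm_nonneg _)
  · exact norm_halfLineResolvent_le_of_bound (hκ i) (fun y => hC (-y)) (-x)
  · exact norm_halfLineResolvent_le_of_bound (hκ i) hC x

theorem isCub_greenFunDeriv (hκ : ∀ i, 0 < (κ i).re) (hδ : ∀ i, δ i ≠ 0) (hf : IsCub f) :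
    IsCub (greenFunDeriv κ δ f) := by
  refine isCub_pi.2 fun i => ?_
  obtain ⟨h1, C, hC⟩ := isCub_pi.1 hf i
  refine isCub_of_hasDerivAt (fun x => hasDerivAt_green_deriv (hκ i) (hδ i) h1.continuous hC x)
    (C := ‖(2 * δ i : ℂ)⁻¹‖ * (C * (κ i).re⁻¹ + C * (κ i).re⁻¹))
    (K := ‖κ i ^ 2‖ * ((‖κ i‖ * |δ i| * (κ i).re)⁻¹ * C) + ‖(δ i : ℂ)⁻¹‖ * C)
    (fun x => ?_) (fun x => ?_)
  · change ‖_ * _‖ ≤ _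
    rw [norm_mul]
    refine mul_le_mul_of_nonneg_left ((norm_sub_le _ _).trans (add_le_add ?_ ?_)) (norm_nonneg _)
    · exact norm_halfLineResolvent_le_of_bound (hκ i) (fun y => hC (-y)) (-x)
    · exact norm_halfLineResolvent_le_of_bound (hκ i) hC x
  · refine (norm_sub_le _ _).trans (add_le_add ?_ ?_)
    · rw [norm_mul]
      exact mul_le_mul_of_nonneg_left (norm_green_le_of_bound (hκ i) hC x) (norm_nonneg _)
    · rw [norm_mul]
      exact mul_le_mul_of_nonneg_left (hC x) (norm_nonneg _)

/-- The differential equation writes the second derivative as a combination of the solution and `f`,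
both in `C_ub`. -/
theorem isC2ub_greenFun (hκ : ∀ i, 0 < (κ i).re) (hδ : ∀ i, δ i ≠ 0) (hf : IsCub f) :
    IsC2ub (greenFun κ δ f) := by
  refine isC2ub_of_hasDerivAt (hasDerivAt_greenFun hκ hδ hf) (hasDerivAt_greenFunDeriv hκ hδ hf)
    (isCub_greenFun hκ hδ hf) (isCub_greenFunDeriv hκ hδ hf) (isCub_pi.2 fun i => ?_)
  exact IsCub.sub ((isCub_pi.1 (isCub_greenFun hκ hδ hf) i).smul (κ i ^ 2))
    ((isCub_pi.1 hf i).smul (δ i : ℂ)⁻¹)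

theorem greenFun_add (hκ : ∀ i, 0 < (κ i).re) {g : ℝ → Val ℂ m n} (hf : IsCub f) (hg : IsCub g)
    (x : ℝ) : greenFun κ δ (f + g) x = greenFun κ δ f x + greenFun κ δ g x := by
  ext1 i
  obtain ⟨h1, C, hC⟩ := isCub_pi.1 hf i
  obtain ⟨h2, K, hK⟩ := isCub_pi.1 hg i
  change green _ _ (fun y => f y i + g y i) x = green _ _ _ x + green _ _ _ x
  simp only [green]
  rw [halfLineResolvent_add (hκ i) h1.continuous hC h2.continuous hK,
    halfLineResolvent_add (f := fun y => f (-y) i) (g := fun y => g (-y) i) (hκ i)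
      (h1.continuous.comp continuous_neg) (fun y => hC (-y))
      (h2.continuous.comp continuous_neg) (fun y => hK (-y))]
  ring

theorem greenFun_smul (c : ℂ) (x : ℝ) : greenFun κ δ (c • f) x = c • greenFun κ δ f x := by
  ext1 i
  change green _ _ (fun y => c * f y i) x = c * green _ _ _ x
  simp only [green, halfLineResolvent_const_mul]
  ring

/-- The operator `(z - D ∂²)⁻¹` on `C_ub`, where `D = diag δ` and `z = δ κ²`. -/
noncomputable def greenOp (hκ : ∀ i, 0 < (κ i).re) (hδ : ∀ i, δ i ≠ 0) :
    BddOp ℂ (Cub ℂ m n) :=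
  LinearMap.mkContinuous
    { toFun := fun f => toCub _ (isCub_greenFun hκ hδ (isCub_coe f))
      map_add' := fun f g => Subtype.ext (DFunLike.ext _ _ fun x =>
        greenFun_add hκ (isCub_coe f) (isCub_coe g) x)
      map_smul' := fun c f => Subtype.ext (DFunLike.ext _ _ fun x =>
        greenFun_smul (f := f.1) c x) }
    (∑ i, (‖κ i‖ * |δ i| * (κ i).re)⁻¹) fun f => by
      have h0 : ∀ i ∈ Finset.univ, 0 ≤ (‖κ i‖ * |δ i| * (κ i).re)⁻¹ := fun i _ => by
        have := hκ i
        positivity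
      refine (Cub.norm_le (mul_nonneg (Finset.sum_nonneg h0) (norm_nonneg f))).2 fun x i => ?_
      refine (norm_green_le_of_bound (hκ i) (fun y => Cub.norm_apply_le f y i) x).trans ?_
      exact mul_le_mul_of_nonneg_right (Finset.single_le_sum h0 (Finset.mem_univ i))
        (norm_nonneg f)

theorem greenOp_apply (hκ : ∀ i, 0 < (κ i).re) (hδ : ∀ i, δ i ≠ 0) (f : Cub ℂ m n) (x : ℝ)
    (i : Fin m ⊕ Fin n) :
    (greenOp hκ hδ f).1 x i = green (κ i) (δ i) (fun y => f.1 y i) x := rfl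

/-- The components decouple and the norm is their maximum, so the largest component bound suffices
instead of the sum used to construct the operator. -/
theorem norm_greenOp_le (hκ : ∀ i, 0 < (κ i).re) (hδ : ∀ i, δ i ≠ 0) {c : ℝ} (hc : 0 ≤ c)
    (h : ∀ i, (‖κ i‖ * |δ i| * (κ i).re)⁻¹ ≤ c) : ‖greenOp hκ hδ‖ ≤ c := by
  refine ContinuousLinearMap.opNorm_le_bound _ hc fun f => ?_
  refine (Cub.norm_le (mul_nonneg hc (norm_nonneg f))).2 fun x i => ?_
  exact (norm_green_le_of_bound (hκ i) (fun y => Cub.norm_apply_le f y i) x).trans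
    (mul_le_mul_of_nonneg_right (h i) (norm_nonneg f))

variable {B : ℝ → Matrix (Fin m ⊕ Fin n) (Fin m ⊕ Fin n) ℝ}

theorem BddOp.map_sub {X : Type} [NormedAddCommGroup X] [NormedSpace ℂ X] (T : BddOp ℂ X)
    (x y : X) : T (x - y) = T x - T y :=
  _root_.map_sub T x y

/-- If `1 + R₀ B` is invertible, where `R₀` is the resolvent of `D ∂²` at `z`, then `z` is in the
resolvent set of `D ∂² - B`, and the resolvent is `(1 + R₀ B)⁻¹ R₀`. -/
theorem isResolventAt_diffOp (hκ : ∀ i, 0 < (κ i).re) (hδ : ∀ i, δ i ≠ 0) {z : ℂ}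
    (hz : ∀ i, δ i * κ i ^ 2 = z) (hB : ∀ i j, IsCub fun x => B x i j) {K : ℝ}
    (hK : ∀ x i j, |B x i j| ≤ K) {S : BddOp ℂ (Cub ℂ m n)}
    (h1 : (1 + greenOp hκ hδ * mulOp ℂ hB K hK) * S = 1)
    (h2 : S * (1 + greenOp hκ hδ * mulOp ℂ hB K hK) = 1) :
    IsResolventAt (X := Cub ℂ m n) (diffOp ℂ δ B) z (S * greenOp hκ hδ) := by
  have hdom : ∀ g : Cub ℂ m n, greenOp hκ hδ g ∈ (diffOp ℂ δ B).domain := fun g => by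
    rw [diffOp_domain δ hB]
    exact isC2ub_greenFun hκ hδ (isCub_coe g)
  refine ⟨fun y => ?_, fun f => ?_⟩
  · set r : Cub ℂ m n := (S * greenOp hκ hδ) y with hr
    set g : Cub ℂ m n := y - mulOp ℂ hB K hK r with hg
    -- Since `(1 + R₀ B) r = R₀ y`, one has `r = R₀ (y - B r)`; this puts `r` in the domain and
    -- yields its second derivative.
    have e1 : r + greenOp hκ hδ (mulOp ℂ hB K hK r) = greenOp hκ hδ y := by
      have := DFunLike.congr_fun h1 (greenOp hκ hδ y)
      exact this
    have e2 : r = greenOp hκ hδ g := by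
      exact (eq_sub_of_add_eq e1).trans (BddOp.map_sub (greenOp hκ hδ) y _).symm
    have hmem : r ∈ (diffOp ℂ δ B).domain := by rw [e2]; exact hdom g
    refine ⟨hmem, Cub.ext' fun x i => ?_⟩
    have e3 : iteratedDeriv 2 r.1 x i = κ i ^ 2 * r.1 x i - (δ i : ℂ)⁻¹ * g.1 x i := by
      rw [e2]
      exact congrFun (congrFun (iteratedDeriv_two_of_hasDerivAt
        (hasDerivAt_greenFun hκ hδ (isCub_coe g))
        (hasDerivAt_greenFunDeriv hκ hδ (isCub_coe g))) x) i
    have e4 : g.1 x i = y.1 x i - ((B x).map (algebraMap ℝ ℂ) *ᵥ r.1 x) i := rfl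
    change z * r.1 x i - diffExpr δ B r.1 x i = y.1 x i
    rw [diffExpr_apply, e3, e4, ← hz i]
    have : (δ i : ℂ) ≠ 0 := by exact_mod_cast hδ i
    simp only [Complex.coe_algebraMap]
    field_simp
    ring
  · have hf : IsC2ub f.1.1 := f.2.1
    have h0 : IsCub f.1.1 := isCub_coe f.1
    set y : Cub ℂ m n := z • (f : Cub ℂ m n) - diffOp ℂ δ B f with hy
    -- The terms with `B` cancel: `y - B f = z f - D f''`, which the Green operator inverts.
    have e1 : greenOp hκ hδ (y - mulOp ℂ hB K hK f.1) = f.1 := by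
      refine Cub.ext' fun x i => ?_
      rw [greenOp_apply]
      obtain ⟨_, C1, hC1⟩ := isCub_pi.1 h0 i
      obtain ⟨_, C2, hC2⟩ := isCub_pi.1 (hf.2 1 (by norm_num)) i
      obtain ⟨h3, C3, hC3⟩ := isCub_pi.1 (isCub_coe (y - mulOp ℂ hB K hK f.1)) i
      refine green_eq (hκ i) (hδ i) (fun x => hasDerivAt_pi.1 (hf.hasDerivAt x) i)
        (fun x => hasDerivAt_pi.1 (hf.hasDerivAt_deriv x) i) hC1 hC2 hC3 h3.continuous
        (fun x => ?_) x
      have e4 : (y - mulOp ℂ hB K hK f.1).1 x i = z * f.1.1 x i - diffExpr δ B f.1.1 x i -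
        ((B x).map (algebraMap ℝ ℂ) *ᵥ f.1.1 x) i := rfl
      rw [e4, diffExpr_apply, ← hz i]
      simp only [Complex.coe_algebraMap]
      ring
    have e2 : greenOp hκ hδ y = (1 + greenOp hκ hδ * mulOp ℂ hB K hK) f.1 := by
      change _ = f.1 + greenOp hκ hδ (mulOp ℂ hB K hK f.1)
      exact sub_eq_iff_eq_add.1 ((BddOp.map_sub (greenOp hκ hδ) y _).symm.trans e1)
    change S (greenOp hκ hδ y) = f.1
    rw [e2]
    exact DFunLike.congr_fun h2 f.1

end GreenOp

/-- The graph is the set where the continuous maps `R (z • x - y)` and `x` of the pair `(x, y)`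
agree. -/
theorem isClosed_of_isResolventAt {X : Type} [NormedAddCommGroup X] [NormedSpace ℂ X]
    {T : X →ₗ.[ℂ] X} {z : ℂ} {R : X →L[ℂ] X} (hR : IsResolventAt T z R) : T.IsClosed := by
  have h : (T.graph : Set (X × X)) = {p | R (z • p.1 - p.2) = p.1} := by
    ext p
    rw [SetLike.mem_coe, LinearPMap.mem_graph_iff]
    constructor
    · rintro ⟨y, h1, h2⟩
      rw [mem_ofPred_eq, ← h1, ← h2]
      exact hR.2 y
    · intro hp
      obtain ⟨h1, h2⟩ := hR.1 (z • p.1 - p.2)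
      refine ⟨⟨_, h1⟩, hp, ?_⟩
      have h3 : z • R (z • p.1 - p.2) = z • p.1 := congrArg (z • ·) hp
      rw [h3] at h2
      exact sub_right_injective h2
  change IsClosed (T.graph : Set (X × X))
  rw [h]
  exact isClosed_eq (by fun_prop) continuous_fst

/-! ### Sectors and invertibility of perturbations of the identity -/

/-- The condition on `z` means `|arg z| ≤ 2π/3`. The square root in the right half-plane then has
argument at most `π/3`, and `cos (π/3) = 1/2` gives `‖κ‖ ≤ 2 Re κ`. -/
theorem exists_sqrt {z : ℂ} (hz0 : z ≠ 0) (hz : -‖z‖ ≤ 2 * z.re) {δ : ℝ} (hδ : 0 < δ) :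
    ∃ κ : ℂ, δ * κ ^ 2 = z ∧ 0 < κ.re ∧ ‖κ‖ ≤ 2 * κ.re ∧ δ * ‖κ‖ ^ 2 = ‖z‖ := by
  have hδ0 : (δ : ℂ) ≠ 0 := by exact_mod_cast hδ.ne'
  obtain ⟨k, hk⟩ := IsAlgClosed.exists_pow_nat_eq (z / δ) (n := 2) (by norm_num)
  obtain ⟨κ, hκ, hre⟩ : ∃ κ : ℂ, κ ^ 2 = z / δ ∧ 0 ≤ κ.re := by
    rcases le_total 0 k.re with h | h
    · exact ⟨k, hk, h⟩
    · exact ⟨-k, by rw [neg_sq, hk], by simpa using h⟩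
  have h1 : δ * κ ^ 2 = z := by rw [hκ]; field_simp
  have h2 : δ * ‖κ‖ ^ 2 = ‖z‖ := by
    rw [← h1, norm_mul, norm_pow, Complex.norm_real, Real.norm_of_nonneg hδ.le]
  have h3 : z.re = δ * (κ.re ^ 2 - κ.im ^ 2) := by
    rw [← h1, Complex.re_ofReal_mul, pow_two, Complex.mul_re]; ring
  have h4 : ‖κ‖ ^ 2 = κ.re ^ 2 + κ.im ^ 2 := by
    rw [Complex.sq_norm, Complex.normSq_apply]; ring
  have h5 : ‖κ‖ ^ 2 ≤ (2 * κ.re) ^ 2 := by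
    have : δ * ‖κ‖ ^ 2 ≤ δ * (2 * κ.re) ^ 2 := by
      rw [← h2, h3, h4] at hz
      rw [h4]
      nlinarith
    exact le_of_mul_le_mul_left this hδ
  have h6 : ‖κ‖ ≤ 2 * κ.re := le_of_sq_le_sq h5 (by positivity)
  have h7 : 0 < ‖κ‖ := by
    rw [norm_pos_iff]
    rintro rfl
    exact hz0 (by rw [← h1]; simp)
  exact ⟨κ, h1, by linarith, h6, h2⟩

/-- Moving the vertex from `0` to `ω > 0` stays inside the sector of half-angle `2π/3` at `0`. With
`w = z - ω`, both other bounds follow from `Re w ≥ -|w|/2` by completing squares in `|ω + w|²`. -/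
theorem sector_bounds {ω : ℝ} (hω : 0 < ω) {z : ℂ} (hz : |Complex.arg (z - ω)| ≤ 2 * Real.pi / 3) :
    -‖z‖ ≤ 2 * z.re ∧ ω ≤ 2 * ‖z‖ ∧ ‖z - ω‖ ≤ 2 * ‖z‖ := by
  obtain ⟨w, rfl⟩ : ∃ w : ℂ, z = ω + w := ⟨z - ω, by ring⟩
  rw [add_sub_cancel_left] at hz ⊢
  have hcos : -(1 / 2) ≤ Real.cos (Complex.arg w) := by
    have h1 : Real.cos (2 * Real.pi / 3) = -(1 / 2) := by
      rw [show 2 * Real.pi / 3 = Real.pi - Real.pi / 3 by ring, Real.cos_pi_sub,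
        Real.cos_pi_div_three]
    rw [← h1, ← Real.cos_abs (Complex.arg w)]
    exact Real.cos_le_cos_of_nonneg_of_le_pi (abs_nonneg _) (by linarith [Real.pi_pos]) hz
  have hre : -(‖w‖ / 2) ≤ w.re := by
    rw [← Complex.norm_mul_cos_arg w]
    nlinarith [norm_nonneg w]
  have e1 : ‖w‖ ^ 2 = w.re ^ 2 + w.im ^ 2 := by
    rw [Complex.sq_norm, Complex.normSq_apply]; ring
  have e2 : ‖(ω : ℂ) + w‖ ^ 2 = (ω + w.re) ^ 2 + w.im ^ 2 := by
    rw [Complex.sq_norm, Complex.normSq_apply]; simp; ring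
  have hn := norm_nonneg ((ω : ℂ) + w)
  have hw := norm_nonneg w
  refine ⟨?_, ?_, ?_⟩
  · simp only [Complex.add_re, Complex.ofReal_re]
    rcases le_total 0 (ω + w.re) with h | h
    · linarith
    · have : (-(2 * (ω + w.re))) ^ 2 ≤ ‖(ω : ℂ) + w‖ ^ 2 := by
        rw [e2]
        have h3 : (-(2 * w.re)) ^ 2 ≤ ‖w‖ ^ 2 := pow_le_pow_left₀ (by linarith) (by linarith) 2
        nlinarith
      have := le_of_sq_le_sq this hn
      linarith
  · refine le_of_sq_le_sq ?_ (by positivity)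
    rw [mul_pow, e2]
    nlinarith [sq_nonneg (ω - ‖w‖), sq_nonneg (ω - ‖w‖ / 2)]
  · refine le_of_sq_le_sq ?_ (by positivity)
    rw [mul_pow, e2]
    nlinarith [sq_nonneg (2 * ω - ‖w‖), sq_nonneg (ω - ‖w‖ / 2)]

/-! ### Neumann series, with a power or in a weighted norm -/

section Invertible

variable {X : Type} [NormedAddCommGroup X] [NormedSpace ℂ X] [CompleteSpace X]

/-- `1 - (-T)^k` factors as `1 + T` times a geometric sum commuting with it, so `1 + T` is a unit as
soon as the product is one. -/
theorem exists_inverse_of_pow {T : BddOp ℂ X} {k : ℕ} (h : ‖T ^ k‖ < 1) :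
    ∃ S : BddOp ℂ X, (1 + T) * S = 1 ∧ S * (1 + T) = 1 := by
  have h1 : IsUnit (1 - (-T) ^ k) := by
    refine isUnit_one_sub_of_norm_lt_one (lt_of_le_of_lt (le_of_eq ?_) h)
    rcases Nat.even_or_odd k with hk | hk
    · rw [hk.neg_pow]
    · rw [hk.neg_pow, norm_neg]
  have hc : Commute (1 - -T) (∑ i ∈ Finset.range k, (-T) ^ i) := by
    rw [commute_iff_eq, mul_neg_geom_sum, geom_sum_mul_neg]
  rw [← mul_neg_geom_sum, hc.isUnit_mul_iff] at h1
  obtain ⟨⟨u, v, huv, hvu⟩, hu⟩ := h1.1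
  refine ⟨v, ?_, ?_⟩
  · rw [← sub_neg_eq_add, ← hu]; exact huv
  · rw [← sub_neg_eq_add, ← hu]; exact hvu

theorem exists_inverse_of_iterate {T : BddOp ℂ X} {k : ℕ} {q : ℝ} (hq0 : 0 ≤ q) (hq : q < 1)
    (h : ∀ f, ‖T^[k] f‖ ≤ q * ‖f‖) : ∃ S : BddOp ℂ X, (1 + T) * S = 1 ∧ S * (1 + T) = 1 := by
  refine exists_inverse_of_pow (k := k)
    (lt_of_le_of_lt (ContinuousLinearMap.opNorm_le_bound _ hq0 fun f => ?_) hq)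
  rw [FunLike.coe_pow_eq_iterate]
  exact h f

omit [CompleteSpace X] in
theorem BddOp.norm_mul_le_of_le {S T : BddOp ℂ X} {a b : ℝ} (hS : ‖S‖ ≤ a) (hT : ‖T‖ ≤ b) :
    ‖S * T‖ ≤ a * b :=
  (norm_mul_le S T).trans (mul_le_mul hS hT (norm_nonneg T) ((norm_nonneg S).trans hS))

/-- The norm bound follows from `S = 1 - T S`, which gives `‖S‖ ≤ 1 + ‖S‖/2`. -/
theorem exists_inverse_of_norm_le_half {T : BddOp ℂ X} (h : ‖T‖ ≤ 1 / 2) :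
    ∃ S : BddOp ℂ X, (1 + T) * S = 1 ∧ S * (1 + T) = 1 ∧ ‖S‖ ≤ 2 := by
  obtain ⟨S, h1, h2⟩ := exists_inverse_of_pow (T := T) (k := 1) (by rw [pow_one]; linarith)
  refine ⟨S, h1, h2, ?_⟩
  have h3 : S = 1 - T * S := by rw [← h1]; noncomm_ring
  have h4 : ‖S‖ ≤ 1 + ‖T‖ * ‖S‖ := by
    calc ‖S‖ = ‖1 - T * S‖ := by rw [← h3]
      _ ≤ ‖(1 : BddOp ℂ X)‖ + ‖T * S‖ := norm_sub_le _ _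
      _ ≤ 1 + ‖T‖ * ‖S‖ := add_le_add ContinuousLinearMap.norm_id_le (norm_mul_le _ _)
  nlinarith [norm_nonneg S]

end Invertible

/-- A contraction with respect to a weighted maximum norm. -/
theorem exists_inverse_of_weight {m n : ℕ} {T : BddOp ℂ (Cub ℂ m n)}
    {ρ : ℝ → Fin m ⊕ Fin n → ℝ} {a b : ℝ} (ha : 0 < a) (haρ : ∀ x i, a ≤ ρ x i)
    (hρb : ∀ x i, ρ x i ≤ b)
    (hT : ∀ (f : Cub ℂ m n) (c : ℝ), 0 ≤ c → (∀ x i, ‖f.1 x i‖ ≤ c * ρ x i) →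
      ∀ x i, ‖(T f).1 x i‖ ≤ 1 / 2 * c * ρ x i) :
    ∃ S : BddOp ℂ (Cub ℂ m n), (1 + T) * S = 1 ∧ S * (1 + T) = 1 := by
  rcases isEmpty_or_nonempty (Fin m ⊕ Fin n) with he | ⟨⟨i₀⟩⟩
  · refine exists_inverse_of_iterate (X := Cub ℂ m n) (k := 1) (le_refl 0) one_pos fun f => ?_
    rw [zero_mul]
    exact (Cub.norm_le le_rfl).2 fun x i => he.elim i
  have hb : 0 < b := ha.trans_le ((haρ 0 i₀).trans (hρb 0 i₀))
  have hpow : ∀ (k : ℕ) (f : Cub ℂ m n) (x : ℝ) (i : Fin m ⊕ Fin n),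
      ‖(T^[k] f).1 x i‖ ≤ (1 / 2) ^ k * (‖f‖ / a) * ρ x i := by
    intro k f
    have hf : 0 ≤ ‖f‖ := norm_nonneg f
    induction k with
    | zero =>
      intro x i
      have h1 : ‖f.1 x i‖ ≤ ‖f‖ := Cub.norm_apply_le f x i
      have h2 : ‖f‖ / a * a ≤ ‖f‖ / a * ρ x i :=
        mul_le_mul_of_nonneg_left (haρ x i) (by positivity)
      rw [div_mul_cancel₀ _ ha.ne'] at h2
      rw [pow_zero, one_mul]
      exact h1.trans h2
    | succ k ih =>
      intro x i
      have := hT (T^[k] f) _ (by positivity) ih x i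
      rw [pow_succ' (1 / 2 : ℝ), Function.iterate_succ_apply']
      refine this.trans (le_of_eq ?_)
      ring
  -- Passing to the weighted norm and back costs the factor `b / a`, which sufficiently many
  -- halvings beat.
  obtain ⟨k, hk⟩ := exists_pow_lt_of_lt_one (show 0 < a / b by positivity)
    (show (1 / 2 : ℝ) < 1 by norm_num)
  refine exists_inverse_of_iterate (X := Cub ℂ m n) (k := k) (q := (1 / 2) ^ k / a * b)
    (by positivity) ?_ fun f => ?_
  rotate_left
  · have hf : 0 ≤ ‖f‖ := norm_nonneg f
    refine (Cub.norm_le (by positivity)).2 fun x i => (hpow k f x i).trans ?_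
    calc (1 / 2) ^ k * (‖f‖ / a) * ρ x i ≤ (1 / 2) ^ k * (‖f‖ / a) * b :=
          mul_le_mul_of_nonneg_left (hρb x i) (by positivity)
      _ = (1 / 2) ^ k / a * b * ‖f‖ := by ring
  · rw [lt_div_iff₀ hb] at hk
    rw [div_mul_eq_mul_div, div_lt_one ha]
    exact hk

/-! ### Sectoriality -/

/-- Since `Re κ ≥ ‖κ‖/2`, the product `‖κ‖ δ Re κ` is at least `δ ‖κ‖²/2 = ‖z‖/2`. -/
theorem inv_norm_sqrt_le {κ z : ℂ} {δ : ℝ} (hδ : 0 < δ) (hκ : 0 < κ.re) (h1 : ‖κ‖ ≤ 2 * κ.re)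
    (h2 : δ * ‖κ‖ ^ 2 = ‖z‖) : (‖κ‖ * |δ| * κ.re)⁻¹ ≤ 2 / ‖z‖ := by
  have h3 : 0 < ‖κ‖ := norm_pos_iff.2 fun h => by simp [h] at hκ
  rw [abs_of_pos hδ, ← h2, inv_eq_one_div, div_le_div_iff₀ (by positivity) (by positivity)]
  nlinarith [mul_pos hδ h3]

theorem exists_entry_bound {m n : ℕ} {B : ℝ → Matrix (Fin m ⊕ Fin n) (Fin m ⊕ Fin n) ℝ}
    (hB : ∀ i j, IsCub fun x => B x i j) : ∃ K, 0 ≤ K ∧ ∀ x i j, |B x i j| ≤ K := by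
  choose C hC using fun i j => (hB i j).2
  refine ⟨∑ i, ∑ j, |C i j|, by positivity, fun x i j => ?_⟩
  calc |B x i j| ≤ |C i j| := (hC i j x).trans (le_abs_self _)
    _ ≤ ∑ j, |C i j| :=
      Finset.single_le_sum (f := fun j => |C i j|) (fun _ _ => abs_nonneg _) (Finset.mem_univ j)
    _ ≤ ∑ i, ∑ j, |C i j| := Finset.single_le_sum (f := fun i => ∑ j, |C i j|)
      (fun _ _ => Finset.sum_nonneg fun _ _ => abs_nonneg _) (Finset.mem_univ i)

/-- `‖z - ω‖ ≤ 2 ‖z‖` turns decay in `‖z‖` into decay in the distance to the vertex, at the cost of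
doubling `M`; the resolvent at `ω` itself gives closedness. -/
theorem isSectorial_of_resolvent {X : Type} [NormedAddCommGroup X] [NormedSpace ℂ X]
    {T : X →ₗ.[ℂ] X} {ω M : ℝ} (hω : 0 < ω) (hM : 0 < M)
    (h : ∀ z : ℂ, |Complex.arg (z - ω)| ≤ 2 * Real.pi / 3 →
      ∃ R : BddOp ℂ X, IsResolventAt T z R ∧ ‖R‖ ≤ M / ‖z‖) : IsSectorial T := by
  have hpi := Real.pi_pos
  refine ⟨?_, ω, 2 * Real.pi / 3, 2 * M, ⟨by linarith, by linarith⟩, by positivity,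
    fun z hz harg => ?_⟩
  · obtain ⟨R, hR, -⟩ := h ω (by simp; positivity)
    exact isClosed_of_isResolventAt hR
  · obtain ⟨R, hR, hn⟩ := h z harg.le
    refine ⟨R, hR, hn.trans ?_⟩
    obtain ⟨-, b2, b3⟩ := sector_bounds hω harg.le
    have h1 : 0 < ‖z - ω‖ := norm_pos_iff.2 (sub_ne_zero.2 hz)
    have hzpos : 0 < ‖z‖ := by linarith
    rw [div_le_div_iff₀ hzpos h1]
    nlinarith

theorem isSectorial_diffOp {m n : ℕ} {δ : Fin m ⊕ Fin n → ℝ} (hδ : ∀ i, 0 < δ i)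
    {B : ℝ → Matrix (Fin m ⊕ Fin n) (Fin m ⊕ Fin n) ℝ} (hB : ∀ i j, IsCub fun x => B x i j) :
    IsSectorial (X := Cub ℂ m n) (diffOp ℂ δ B) := by
  obtain ⟨K, hK0, hK⟩ := exists_entry_bound hB
  set N : ℝ := (m + n : ℕ) * K with hN
  have hN0 : 0 ≤ N := by positivity
  -- On the sector `‖z‖ ≥ ω/2 ≥ 4 N`, hence `‖R₀ B‖ ≤ 2 N / ‖z‖ ≤ 1/2`.
  set ω : ℝ := 8 * N + 1 with hω
  have hω0 : 0 < ω := by positivity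
  have key : ∀ z : ℂ, |Complex.arg (z - ω)| ≤ 2 * Real.pi / 3 →
      ∃ R : BddOp ℂ (Cub ℂ m n), IsResolventAt (X := Cub ℂ m n) (diffOp ℂ δ B) z R ∧
        ‖R‖ ≤ 4 / ‖z‖ := by
    intro z hz
    obtain ⟨b1, b2, -⟩ := sector_bounds hω0 hz
    have hzpos : 0 < ‖z‖ := by linarith
    choose κ e1 e2 e3 e4 using fun i => exists_sqrt (norm_pos_iff.1 hzpos) b1 (hδ i)
    have hδ' : ∀ i, δ i ≠ 0 := fun i => (hδ i).ne'
    have hR0 : ‖greenOp e2 hδ'‖ ≤ 2 / ‖z‖ := norm_greenOp_le e2 hδ' (by positivity) fun i =>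
      inv_norm_sqrt_le (hδ i) (e2 i) (e3 i) (e4 i)
    have hRB : ‖greenOp e2 hδ' * mulOp ℂ hB K hK‖ ≤ 1 / 2 := by
      refine (BddOp.norm_mul_le_of_le (X := Cub ℂ m n) hR0 (norm_mulOp_le hB hK0 hK)).trans ?_
      rw [div_mul_eq_mul_div, div_le_div_iff₀ hzpos (by norm_num)]
      linarith
    obtain ⟨S, s1, s2, s3⟩ := exists_inverse_of_norm_le_half (X := Cub ℂ m n) hRB
    exact ⟨S * greenOp e2 hδ', isResolventAt_diffOp e2 hδ' e1 hB hK s1 s2,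
      (BddOp.norm_mul_le_of_le (X := Cub ℂ m n) s3 hR0).trans_eq (by ring)⟩
  exact isSectorial_of_resolvent (X := Cub ℂ m n) hω0 (by norm_num : (0 : ℝ) < 4) key

/-! ### Periodic exponential weights -/

/-- The `P`-periodic weight `exp (-b dist(x, P ℤ))`. -/
noncomputable def periodicWeight (b P x : ℝ) : ℝ := Real.exp (-b * ‖(x : AddCircle P)‖)

section PeriodicWeight

variable {b P : ℝ}

theorem periodicWeight_pos (x : ℝ) : 0 < periodicWeight b P x := Real.exp_pos _

theorem periodicWeight_le_one (hb : 0 ≤ b) (x : ℝ) : periodicWeight b P x ≤ 1 := by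
  rw [periodicWeight, Real.exp_le_one_iff]
  nlinarith [norm_nonneg (x : AddCircle P)]

theorem periodic_periodicWeight : Function.Periodic (periodicWeight b P) P := fun x => by
  simp [periodicWeight]

theorem continuous_periodicWeight : Continuous (periodicWeight b P) := by
  unfold periodicWeight
  have : Continuous fun x : ℝ => ‖(x : AddCircle P)‖ :=
    continuous_norm.comp (AddCircle.continuous_mk' P)
  fun_prop

theorem norm_coe_addCircle_le (x : ℝ) : ‖(x : AddCircle P)‖ ≤ |x| := by
  have h := QuotientAddGroup.norm_mk_le_norm (S := AddSubgroup.zmultiples P) (m := x)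
  exact h

/-- The distance to `P ℤ` is 1-Lipschitz, so the weight varies at exponential rate at most `b`. -/
theorem periodicWeight_le_mul_exp (hb : 0 ≤ b) (x y : ℝ) :
    periodicWeight b P y ≤ periodicWeight b P x * Real.exp (b * |x - y|) := by
  rw [periodicWeight, periodicWeight, ← Real.exp_add, Real.exp_le_exp]
  have h1 : ‖(x : AddCircle P)‖ ≤ ‖((x - y : ℝ) : AddCircle P)‖ + ‖(y : AddCircle P)‖ := by
    have : (x : AddCircle P) = ((x - y : ℝ) : AddCircle P) + (y : AddCircle P) := by
      rw [← AddCircle.coe_add, sub_add_cancel]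
    rw [this]
    exact norm_add_le _ _
  have h2 := norm_coe_addCircle_le (P := P) (x - y)
  nlinarith

theorem le_periodicWeight (hb : 0 ≤ b) {x : ℝ} (h0 : 0 ≤ x) (h1 : x ≤ P) :
    Real.exp (-b * min x (P - x)) ≤ periodicWeight b P x := by
  rw [periodicWeight, Real.exp_le_exp]
  have e1 : ‖(x : AddCircle P)‖ ≤ x := (norm_coe_addCircle_le x).trans_eq (abs_of_nonneg h0)
  have e2 : ‖(x : AddCircle P)‖ ≤ P - x := by
    have h2 := norm_coe_addCircle_le (P := P) (P - x)
    rw [AddCircle.coe_sub, AddCircle.coe_period, zero_sub, norm_neg,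
      abs_of_nonneg (by linarith)] at h2
    exact h2
  nlinarith [le_min e1 e2]

/-- On `[0, P]` the nearest lattice point is `0` or `P`. -/
theorem periodicWeight_le (hP : 0 < P) {x : ℝ} (h0 : 0 ≤ x) (h1 : x ≤ P) :
    periodicWeight b P x ≤ Real.exp (-b * x) + Real.exp (-b * (P - x)) := by
  rw [periodicWeight]
  rcases le_total x (P / 2) with h | h
  · rw [(AddCircle.norm_coe_eq_abs_iff (p := P) hP.ne').2
      (by rwa [abs_of_nonneg h0, abs_of_pos hP]), abs_of_nonneg h0]
    linarith [Real.exp_pos (-b * (P - x))]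
  · have e : ‖(x : AddCircle P)‖ = ‖((P - x : ℝ) : AddCircle P)‖ := by
      rw [AddCircle.coe_sub, AddCircle.coe_period, zero_sub, norm_neg]
    rw [e, (AddCircle.norm_coe_eq_abs_iff (p := P) hP.ne').2
      (by rw [abs_of_nonneg (by linarith), abs_of_pos hP]; linarith),
      abs_of_nonneg (by linarith)]
    linarith [Real.exp_pos (-b * x)]

theorem integral_exp_neg_mul_le (hb : 0 < b) (P : ℝ) :
    ∫ s in (0 : ℝ)..P, Real.exp (-b * s) ≤ 1 / b := by
  have hd : ∀ s ∈ uIcc 0 P, HasDerivAt (fun s : ℝ => -(Real.exp (-b * s) / b))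
      (Real.exp (-b * s)) s := fun s _ => by
    have h1 : HasDerivAt (fun s : ℝ => -b * s) (-b) s := by
      simpa using (hasDerivAt_id s).const_mul (-b)
    refine (h1.exp.div_const b).neg.congr_deriv ?_
    field_simp
  rw [intervalIntegral.integral_eq_sub_of_hasDerivAt hd
    (Continuous.intervalIntegrable (by fun_prop) _ _)]
  have : 0 < Real.exp (-b * P) / b := by positivity
  rw [mul_zero, Real.exp_zero]
  linarith

/-- The bound does not involve the period. For `b = β/ε` it is `O(ε)`, which offsets a coefficient
`ε⁻¹`. -/
theorem integral_periodicWeight_le (hb : 0 < b) (hP : 0 < P) :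
    ∫ s in (0 : ℝ)..P, periodicWeight b P s ≤ 2 / b := by
  have h1 : IntervalIntegrable (fun s => Real.exp (-b * s)) MeasureTheory.volume 0 P :=
    Continuous.intervalIntegrable (by fun_prop) _ _
  have h2 : IntervalIntegrable (fun s => Real.exp (-b * (P - s))) MeasureTheory.volume 0 P :=
    Continuous.intervalIntegrable (by fun_prop) _ _
  calc ∫ s in (0 : ℝ)..P, periodicWeight b P s
      ≤ ∫ s in (0 : ℝ)..P, (Real.exp (-b * s) + Real.exp (-b * (P - s))) :=
        intervalIntegral.integral_mono_on hP.le (continuous_periodicWeight.intervalIntegrable _ _)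
          (h1.add h2) fun x hx => periodicWeight_le hP hx.1 hx.2
    _ = (∫ s in (0 : ℝ)..P, Real.exp (-b * s)) + ∫ s in (0 : ℝ)..P, Real.exp (-b * s) := by
        rw [intervalIntegral.integral_add h1 h2,
          intervalIntegral.integral_comp_sub_left (fun s => Real.exp (-b * s)) P]
        simp
    _ ≤ 2 / b := by
        have := integral_exp_neg_mul_le hb P
        have e : 2 / b = 1 / b + 1 / b := by ring
        linarith

theorem integrableOn_exp_mul_periodicWeight (hb : 0 ≤ b) {a : ℝ} (ha : 0 < a) (x c : ℝ) :
    MeasureTheory.IntegrableOn (fun s => Real.exp (-a * s) * periodicWeight b P (x - s))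
      (Ioi c) := by
  refine MeasureTheory.Integrable.mul_bdd (c := 1)
    (integrableOn_exp_mul_Ioi (a := -a) (by linarith) c) ?_ (Eventually.of_forall fun s => ?_)
  · exact (continuous_periodicWeight.comp (by fun_prop)).aestronglyMeasurable
  · rw [Real.norm_of_nonneg (periodicWeight_pos _).le]
    exact periodicWeight_le_one hb _

/-- By periodicity of the weight, the integral over `(P, ∞)` is `exp (-a P)` times the whole
integral. Solving for the latter leaves one period, on which the kernel is at most `1`. -/
theorem integral_exp_mul_periodicWeight_le (hb : 0 < b) (hP : 0 < P) {a : ℝ} (ha : 0 < a)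
    (x : ℝ) : ∫ s in Ioi (0 : ℝ), Real.exp (-a * s) * periodicWeight b P (x - s) ≤
      2 / b / (1 - Real.exp (-a * P)) := by
  set F : ℝ → ℝ := fun s => Real.exp (-a * s) * periodicWeight b P (x - s) with hF
  have hFi := fun c => integrableOn_exp_mul_periodicWeight (P := P) hb.le ha x c
  have hFc : Continuous F := by
    have := continuous_periodicWeight (b := b) (P := P)
    fun_prop
  have hexp : Real.exp (-a * P) < 1 := by
    rw [Real.exp_lt_one_iff]; nlinarith
  have e1 : (∫ s in (0 : ℝ)..P, F s) + ∫ s in Ioi P, F s = ∫ s in Ioi (0 : ℝ), F s := by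
    rw [← intervalIntegral.integral_Ioi_sub_Ioi (hFi 0) hP.le]
    ring
  have e2 : ∫ s in Ioi P, F s = Real.exp (-a * P) * ∫ s in Ioi (0 : ℝ), F s := by
    rw [← MeasureTheory.integral_const_mul]
    have h3 := MeasureTheory.integral_add_right_eq_self (μ := MeasureTheory.volume)
      ((Ioi P).indicator F) P
    rw [MeasureTheory.integral_indicator measurableSet_Ioi] at h3
    rw [← h3, ← MeasureTheory.integral_indicator measurableSet_Ioi]
    congr 1
    ext1 s
    by_cases hs : 0 < s
    swap
    · rw [indicator_of_notMem (by simpa using hs), indicator_of_notMem (by simpa using hs)]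
    rw [indicator_of_mem (by simpa using hs), indicator_of_mem (by simpa using hs), hF]
    simp only
    have h4 : periodicWeight b P (x - (s + P)) = periodicWeight b P (x - s) := by
      rw [← periodic_periodicWeight (x - (s + P))]
      congr 1; ring
    rw [h4, show -a * (s + P) = -a * P + -a * s by ring, Real.exp_add]
    ring
  have e3 : ∫ s in (0 : ℝ)..P, F s ≤ 2 / b := by
    calc ∫ s in (0 : ℝ)..P, F s ≤ ∫ s in (0 : ℝ)..P, periodicWeight b P (x - s) := by
          refine intervalIntegral.integral_mono_on hP.le (hFc.intervalIntegrable _ _)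
            ((continuous_periodicWeight.comp (by fun_prop)).intervalIntegrable _ _)
            fun s hs => ?_
          refine mul_le_of_le_one_left (periodicWeight_pos _).le ?_
          rw [Real.exp_le_one_iff]
          nlinarith [hs.1]
      _ = ∫ s in (0 : ℝ)..P, periodicWeight b P s := by
          rw [intervalIntegral.integral_comp_sub_left (periodicWeight b P) x, sub_zero]
          have := periodic_periodicWeight (b := b) (P := P) |>.intervalIntegral_add_eq (x - P) 0
          rw [sub_add_cancel, zero_add] at this
          exact this
      _ ≤ 2 / b := integral_periodicWeight_le hb hP
  rw [le_div_iff₀ (by linarith)]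
  rw [e2] at e1
  linarith

end PeriodicWeight

/-! ### A sector in the resolvent set for localized coefficients -/

theorem norm_halfLineResolvent_le_of_localized {κ : ℂ} {f : ℝ → ℂ} {b P c : ℝ} (hb : 0 < b)
    (hP : 0 < P) (hκ : 0 < κ.re) {k : ℝ}
    (hf : ∀ y, ‖f y‖ ≤ c * (1 + k * periodicWeight b P y)) (hc : 0 ≤ c) (hk : 0 ≤ k) (x : ℝ) :
    ‖halfLineResolvent κ f x‖ ≤
      c * (κ.re⁻¹ + k * (2 / b / (1 - Real.exp (-κ.re * P)))) := by
  have i1 : MeasureTheory.IntegrableOn (fun s : ℝ => Real.exp (-κ.re * s)) (Ioi 0) :=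
    integrableOn_exp_mul_Ioi (a := -κ.re) (by linarith) 0
  have i2 := integrableOn_exp_mul_periodicWeight (P := P) hb.le hκ x 0
  have e : (fun s : ℝ => Real.exp (-κ.re * s) * (c * (1 + k * periodicWeight b P (x - s)))) =
      fun s : ℝ => c * (Real.exp (-κ.re * s) +
        k * (Real.exp (-κ.re * s) * periodicWeight b P (x - s))) := by
    ext1 s; ring
  refine (norm_halfLineResolvent_le x hf ?_).trans ?_
  · rw [e]
    exact (i1.add (i2.const_mul k)).const_mul c
  · rw [e, MeasureTheory.integral_const_mul, MeasureTheory.integral_add i1 (i2.const_mul k),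
      MeasureTheory.integral_const_mul, integral_exp_neg_mul_Ioi hκ]
    have := integral_exp_mul_periodicWeight_le hb hP hκ x
    gcongr

theorem norm_green_le_of_localized {κ : ℂ} {δ : ℝ} {f : ℝ → ℂ} {b P c : ℝ} (hb : 0 < b)
    (hP : 0 < P) (hκ : 0 < κ.re) {k : ℝ}
    (hf : ∀ y, ‖f y‖ ≤ c * (1 + k * periodicWeight b P y)) (hc : 0 ≤ c) (hk : 0 ≤ k) (x : ℝ) :
    ‖green κ δ f x‖ ≤ (‖κ‖ * |δ|)⁻¹ *
      (c * (κ.re⁻¹ + k * (2 / b / (1 - Real.exp (-κ.re * P))))) := by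
  refine (norm_green_le (norm_halfLineResolvent_le_of_localized hb hP hκ hf hc hk x)
    (norm_halfLineResolvent_le_of_localized (f := fun y => f (-y)) hb hP hκ (fun y => ?_) hc hk
      (-x))).trans (le_of_eq ?_)
  · have h1 := hf (-y)
    have h2 : periodicWeight b P (-y) = periodicWeight b P y := by
      simp [periodicWeight]
    rwa [h2] at h1
  · rw [mul_inv, mul_inv, mul_inv]
    ring

/-- The peak `ε⁻¹ w` has mass at most `2/β` per period, so the convolution with the kernel is
bounded by `N c Q`, uniformly in `ε`. The prefactor `1/(‖k‖ d)` then makes it small for large `r`.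
-/
theorem norm_green_slow_le {k : ℂ} {d r N Q P P₀ β ε c : ℝ} {f : ℝ → ℂ} (hβ : 0 < β)
    (hε : 0 < ε) (hP₀ : 0 < P₀) (hP : P₀ ≤ P) (hN : 0 ≤ N) (hc : 0 ≤ c) (hd : 0 < d)
    (hQ : Q = 1 + 2 / β / (1 - Real.exp (-P₀))) (k0 : 0 < k.re) (k1 : ‖k‖ ≤ 2 * k.re)
    (k2 : d * ‖k‖ ^ 2 = r) (hr : 4 * d + 4 * (N * Q) ^ 2 / d ≤ r)
    (hf : ∀ y, ‖f y‖ ≤ N * c * (1 + ε⁻¹ * periodicWeight (β / ε) P y)) (x : ℝ) :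
    ‖green k d f x‖ ≤ 1 / 2 * c := by
  have hb : 0 < β / ε := by positivity
  have hNc : 0 ≤ N * c := by positivity
  have q6 : 0 < 1 - Real.exp (-P₀) := by
    have : Real.exp (-P₀) < 1 := by rw [Real.exp_lt_one_iff]; linarith
    linarith
  have hQ0 : 0 < Q := by rw [hQ]; positivity
  have q1 : 0 ≤ 4 * (N * Q) ^ 2 / d := by positivity
  -- The term `4 d` in the lower bound for `r` serves to give `Re k ≥ 1`, so that `exp (-Re k P) ≤
  -- exp (-P₀)`.
  have hk2 : 2 ≤ ‖k‖ := by
    refine le_of_sq_le_sq ?_ (norm_nonneg k)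
    refine le_of_mul_le_mul_left ?_ hd
    linarith
  have hre : 1 ≤ k.re := by linarith
  have hkd : 2 * (N * Q) ≤ ‖k‖ * d := by
    refine le_of_sq_le_sq ?_ (by positivity)
    have q2 : 4 * (N * Q) ^ 2 / d ≤ r := by linarith
    rw [div_le_iff₀ hd, ← k2] at q2
    nlinarith
  refine (norm_green_le_of_localized (k := ε⁻¹) hb (hP₀.trans_le hP) k0 hf hNc
    (by positivity) x).trans ?_
  have q3 : k.re⁻¹ + ε⁻¹ * (2 / (β / ε) / (1 - Real.exp (-k.re * P))) ≤ Q := by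
    have q4 : ε⁻¹ * (2 / (β / ε) / (1 - Real.exp (-k.re * P))) =
        2 / β / (1 - Real.exp (-k.re * P)) := by
      field_simp
    have q5 : Real.exp (-k.re * P) ≤ Real.exp (-P₀) := by
      rw [Real.exp_le_exp]
      nlinarith
    rw [q4, hQ]
    have q7 : k.re⁻¹ ≤ 1 := inv_le_one_of_one_le₀ hre
    gcongr
  rw [abs_of_pos hd]
  calc (‖k‖ * d)⁻¹ * (N * c * (k.re⁻¹ + ε⁻¹ * (2 / (β / ε) / (1 - Real.exp (-k.re * P)))))
      ≤ (‖k‖ * d)⁻¹ * (N * c * Q) := by gcongr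
    _ ≤ 1 / 2 * c := by
      rw [inv_mul_le_iff₀ (by positivity)]
      nlinarith

/-- With diffusion `ε² d` the kernel decays at rate `Re k ≥ ‖k‖/2 ≥ 2β/ε`, twice the rate of the
weight. Hence `w + ε` is reproduced with the factor `4 N / r ≤ 1/2`. -/
theorem norm_green_fast_le {k : ℂ} {d r N P β ε c : ℝ} {f : ℝ → ℂ} (hβ : 0 < β)
    (hε : 0 < ε) (hN : 0 ≤ N) (hc : 0 ≤ c) (hd : 0 < d) (k1 : ‖k‖ ≤ 2 * k.re)
    (k2 : ε ^ 2 * d * ‖k‖ ^ 2 = r) (hr : 16 * β ^ 2 * d ≤ r) (hrN : 8 * N ≤ r)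
    (hf : ∀ y, ‖f y‖ ≤ N * c * (periodicWeight (β / ε) P y + ε)) (x : ℝ) :
    ‖green k (ε ^ 2 * d) f x‖ ≤ 1 / 2 * c * (periodicWeight (β / ε) P x + ε) := by
  have hb : 0 < β / ε := by positivity
  have hNc : 0 ≤ N * c := by positivity
  have hk : 4 * β ≤ ε * ‖k‖ := by
    refine le_of_sq_le_sq ?_ (by positivity)
    refine le_of_mul_le_mul_left ?_ hd
    nlinarith
  have hk' : β / ε ≤ ‖k‖ / 4 := by
    rw [div_le_iff₀ hε]; linarith
  have hkpos : 0 < ‖k‖ := by nlinarith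
  have hrpos : 0 < r := by rw [← k2]; positivity
  have hμ : β / ε < k.re := by linarith
  have hwρ : ∀ x y, periodicWeight (β / ε) P y + ε ≤
      (periodicWeight (β / ε) P x + ε) * Real.exp (β / ε * |x - y|) := fun x y => by
    have q1 := periodicWeight_le_mul_exp (P := P) hb.le x y
    have q2 : 1 ≤ Real.exp (β / ε * |x - y|) := Real.one_le_exp (by positivity)
    rw [add_mul]
    refine add_le_add q1 ?_
    nlinarith
  refine (norm_green_le_of_weight (ρ := fun y => periodicWeight (β / ε) P y + ε) hμ hwρ hNc hf
    x).trans ?_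
  have hwx : 0 < periodicWeight (β / ε) P x := periodicWeight_pos x
  have q3 : (‖k‖ * |ε ^ 2 * d| * (k.re - β / ε))⁻¹ ≤ 4 / r := by
    rw [abs_of_pos (by positivity), ← k2, inv_eq_one_div,
      div_le_div_iff₀ (mul_pos (by positivity) (by linarith)) (by positivity)]
    have q4 : ‖k‖ / 4 ≤ k.re - β / ε := by linarith
    have q5 : 0 ≤ ‖k‖ * (ε ^ 2 * d) := by positivity
    nlinarith [mul_le_mul_of_nonneg_left q4 q5]
  calc (‖k‖ * |ε ^ 2 * d| * (k.re - β / ε))⁻¹ * (N * c * (periodicWeight (β / ε) P x + ε))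
      ≤ 4 / r * (N * c * (periodicWeight (β / ε) P x + ε)) := by gcongr
    _ ≤ 1 / 2 * c * (periodicWeight (β / ε) P x + ε) := by
      rw [div_mul_eq_mul_div, div_le_iff₀ hrpos]
      have : 0 ≤ c * (periodicWeight (β / ε) P x + ε) := by positivity
      nlinarith

/-- The `u`-component is weighted by `1` and the `v`-component by `w + ε`. In these weights every
block of `B` maps into the input class of the slow or of the fast Green estimate, with constants
independent of `ε` and of `P ≥ P₀`. -/
theorem exists_sector_subset_resolventSet {m n : ℕ} {d₁ : Fin m → ℝ} {d₂ : Fin n → ℝ}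
    (hd₁ : ∀ i, 0 < d₁ i) (hd₂ : ∀ i, 0 < d₂ i) {C β P₀ : ℝ} (hC : 0 ≤ C) (hβ : 0 < β)
    (hP₀ : 0 < P₀) :
    ∃ ω : ℝ, 0 < ω ∧ ∀ (ε P : ℝ) (B : ℝ → Matrix (Fin m ⊕ Fin n) (Fin m ⊕ Fin n) ℝ),
      0 < ε → ε ≤ 1 → P₀ ≤ P → (∀ i j, IsCub fun x => B x i j) →
      (∀ x i j, |B x (Sum.inl i) (Sum.inl j)| ≤ C * (1 + ε⁻¹ * periodicWeight (β / ε) P x)) →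
      (∀ x i j, |B x (Sum.inl i) (Sum.inr j)| ≤ C * ε⁻¹) →
      (∀ x i j, |B x (Sum.inr i) (Sum.inl j)| ≤ C * periodicWeight (β / ε) P x) →
      (∀ x i j, |B x (Sum.inr i) (Sum.inr j)| ≤ C) →
      sector ω (2 * Real.pi / 3) ⊆ resolventSet (X := Cub ℂ m n)
        (diffOp ℂ (Sum.elim d₁ (fun i => ε ^ 2 * d₂ i)) B) := by
  set N : ℝ := (m + n : ℕ) * C with hN
  have hN0 : 0 ≤ N := by positivity
  have hexp₀ : Real.exp (-P₀) < 1 := by rw [Real.exp_lt_one_iff]; linarith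
  set Q : ℝ := 1 + 2 / β / (1 - Real.exp (-P₀)) with hQ
  have hQ0 : 0 < Q := by
    have : 0 < 1 - Real.exp (-P₀) := by linarith
    positivity
  set s₁ : ℝ := ∑ i, (4 * d₁ i + 4 * (N * Q) ^ 2 / d₁ i) with hs₁
  set s₂ : ℝ := ∑ i, 16 * β ^ 2 * d₂ i with hs₂
  have ht₁ : ∀ i ∈ Finset.univ, 0 ≤ 4 * d₁ i + 4 * (N * Q) ^ 2 / d₁ i := fun i _ => by
    have := hd₁ i
    positivity
  have ht₂ : ∀ i ∈ Finset.univ, 0 ≤ 16 * β ^ 2 * d₂ i := fun i _ => by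
    have := hd₂ i
    positivity
  have hs₁0 : 0 ≤ s₁ := Finset.sum_nonneg ht₁
  have hs₂0 : 0 ≤ s₂ := Finset.sum_nonneg ht₂
  -- The factor `2` compensates `‖z‖ ≥ ω/2`; the sums dominate the thresholds of all slow and fast
  -- components at once, and `8 N` is the remaining fast threshold.
  refine ⟨2 * (s₁ + s₂ + 8 * N + 1), by positivity, ?_⟩
  set ω : ℝ := 2 * (s₁ + s₂ + 8 * N + 1) with hω
  have hω0 : 0 < ω := by positivity
  intro ε P B hε hε1 hP hB h11 h12 h21 h22 z hz
  have harg : |Complex.arg (z - ω)| ≤ 2 * Real.pi / 3 := by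
    rcases hz with hz | hz
    · exact hz.2
    · rw [mem_singleton_iff.1 hz, sub_self, Complex.arg_zero, abs_zero]
      positivity
  obtain ⟨b1, b2, -⟩ := sector_bounds hω0 harg
  have hzs₁ : s₁ ≤ ‖z‖ := by linarith
  have hzs₂ : s₂ ≤ ‖z‖ := by linarith
  have hzN : 8 * N ≤ ‖z‖ := by linarith
  have hzpos : 0 < ‖z‖ := by linarith
  have hδ : ∀ i, 0 < Sum.elim d₁ (fun i => ε ^ 2 * d₂ i) i := by
    rintro (i | i)
    · exact hd₁ i
    · have := hd₂ i
      simp only [Sum.elim_inr]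
      positivity
  choose κ e1 e2 e3 e4 using fun i => exists_sqrt (norm_pos_iff.1 hzpos) b1 (hδ i)
  have hδ' : ∀ i, Sum.elim d₁ (fun i => ε ^ 2 * d₂ i) i ≠ 0 := fun i => (hδ i).ne'
  obtain ⟨K, hK0, hK⟩ := exists_entry_bound hB
  have hb : 0 < β / ε := by positivity
  set w : ℝ → ℝ := periodicWeight (β / ε) P with hw
  have hw0 : ∀ x, 0 < w x := periodicWeight_pos
  have hw1 : ∀ x, w x ≤ 1 := periodicWeight_le_one hb.le
  set ρ : ℝ → Fin m ⊕ Fin n → ℝ := fun x => Sum.elim (fun _ => 1) (fun _ => w x + ε) with hρ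
  suffices hT : ∀ (f : Cub ℂ m n) (c : ℝ), 0 ≤ c → (∀ x i, ‖f.1 x i‖ ≤ c * ρ x i) →
      ∀ x i, ‖((greenOp e2 hδ' * mulOp ℂ hB K hK) f).1 x i‖ ≤ 1 / 2 * c * ρ x i by
    have hρε : ∀ x i, ε ≤ ρ x i := by
      rintro x (i | i)
      · exact hε1
      · simp only [hρ, Sum.elim_inr]
        linarith [hw0 x]
    have hρ2 : ∀ x i, ρ x i ≤ 2 := by
      rintro x (i | i)
      · simp only [hρ, Sum.elim_inl]
        norm_num
      · simp only [hρ, Sum.elim_inr]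
        linarith [hw1 x]
    obtain ⟨S, S1, S2⟩ := exists_inverse_of_weight hε hρε hρ2 hT
    exact ⟨_, isResolventAt_diffOp e2 hδ' e1 hB hK S1 S2⟩
  intro f c hc hf
  set g : Cub ℂ m n := mulOp ℂ hB K hK f with hg
  have hgx : ∀ x i, ‖g.1 x i‖ ≤ ∑ j, |B x i j| * (c * ρ x j) := fun x i => by
    have : g.1 x i = ∑ j, algebraMap ℝ ℂ (B x i j) * f.1 x j := rfl
    rw [this]
    refine (norm_sum_le _ _).trans (Finset.sum_le_sum fun j _ => ?_)
    rw [norm_mul, norm_algebraMap', Real.norm_eq_abs]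
    exact mul_le_mul_of_nonneg_left (hf x j) (abs_nonneg _)
  have hg1 : ∀ x i, ‖g.1 x (Sum.inl i)‖ ≤ N * c * (1 + ε⁻¹ * w x) := fun x i => by
    refine (hgx x _).trans ?_
    have : ∀ j ∈ Finset.univ, |B x (Sum.inl i) j| * (c * ρ x j) ≤
        C * c * (1 + ε⁻¹ * w x) := by
      rintro (j | j) -
      · refine (mul_le_mul_of_nonneg_right (h11 x i j) (by simpa [hρ] using hc)).trans
          (le_of_eq ?_)
        simp only [hρ, Sum.elim_inl]
        ring
      -- Here the choice of weight pays: `ε⁻¹ (w + ε) = 1 + ε⁻¹ w`, the admissible right-hand side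
      -- of the slow equation.
      · have hρ0 : 0 ≤ c * ρ x (Sum.inr j) := by
          have := hw0 x
          simp only [hρ, Sum.elim_inr]
          positivity
        refine (mul_le_mul_of_nonneg_right (h12 x i j) hρ0).trans (le_of_eq ?_)
        simp only [hρ, Sum.elim_inr]
        field_simp
        ring
    refine (Finset.sum_le_card_nsmul _ _ _ this).trans (le_of_eq ?_)
    simp [hN]
    ring
  have hg2 : ∀ x i, ‖g.1 x (Sum.inr i)‖ ≤ N * c * (w x + ε) := fun x i => by
    refine (hgx x _).trans ?_
    have : ∀ j ∈ Finset.univ, |B x (Sum.inr i) j| * (c * ρ x j) ≤ C * c * (w x + ε) := by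
      rintro (j | j) -
      · refine (mul_le_mul_of_nonneg_right (h21 x i j) (by simpa [hρ] using hc)).trans ?_
        simp only [hρ, Sum.elim_inl]
        have : 0 ≤ C * c * ε := by positivity
        linarith
      · have hρ0 : 0 ≤ c * ρ x (Sum.inr j) := by
          have := hw0 x
          simp only [hρ, Sum.elim_inr]
          positivity
        refine (mul_le_mul_of_nonneg_right (h22 x i j) hρ0).trans (le_of_eq ?_)
        simp only [hρ, Sum.elim_inr]
        ring
    refine (Finset.sum_le_card_nsmul _ _ _ this).trans (le_of_eq ?_)
    simp [hN]
    ring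
  rintro x (i | i)
  · rw [show 1 / 2 * c * ρ x (Sum.inl i) = 1 / 2 * c from mul_one _]
    exact norm_green_slow_le hβ hε hP₀ hP hN0 hc (hd₁ i) hQ (e2 (Sum.inl i)) (e3 (Sum.inl i))
      (e4 (Sum.inl i)) ((Finset.single_le_sum ht₁ (Finset.mem_univ i)).trans hzs₁)
      (fun y => hg1 y i) x
  · exact norm_green_fast_le hβ hε hN0 hc (hd₂ i) (e3 (Sum.inr i)) (e4 (Sum.inr i))
      ((Finset.single_le_sum ht₂ (Finset.mem_univ i)).trans hzs₂) hzN (fun y => hg2 y i) x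

/-! ### Continuous dependence on initial values -/

theorem exists_lipschitzOnWith_of_isCompact {E F : Type} [NormedAddCommGroup E] [NormedSpace ℝ E]
    [NormedAddCommGroup F] [NormedSpace ℝ F] {f : E → F} {Ω K : Set E} (hΩ : IsOpen Ω)
    (hf : ContDiffOn ℝ 1 f Ω) (hK : IsCompact K) (hKΩ : K ⊆ Ω) : ∃ C, LipschitzOnWith C f K := by
  refine LocallyLipschitzOn.exists_lipschitzOnWith_of_compact hK fun x hx => ?_
  obtain ⟨C, t, ht, hC⟩ :=
    (hf.contDiffAt (hΩ.mem_nhds (hKΩ hx))).exists_lipschitzOnWith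
  exact ⟨C, t, mem_nhdsWithin_of_mem_nhds ht, hC⟩

/-- Comparison with an exponential barrier: the differential inequality is needed only where `‖y -
y₀‖` touches the barrier. There `y` lies in a compact tube inside `Ω`, so neither `y ∈ Ω` nor a
global Lipschitz bound has to be assumed. -/
theorem continuous_dependence_forward {E : Type} [NormedAddCommGroup E] [NormedSpace ℝ E]
    [ProperSpace E] {F : E → E} {Ω : Set E} (hΩ : IsOpen Ω) (hF : ContDiffOn ℝ 1 F Ω)
    {y₀ : ℝ → E} (hy₀ : ∀ x, HasDerivAt y₀ (F (y₀ x)) x) (hy₀Ω : ∀ x, y₀ x ∈ Ω) {X r : ℝ}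
    (hr : 0 < r) : ∃ η > 0, ∀ y : ℝ → E, (∀ x, HasDerivAt y (F (y x)) x) →
      ‖y 0 - y₀ 0‖ ≤ η → ∀ x ∈ Icc 0 X, ‖y x - y₀ x‖ ≤ r := by
  have hcont : Continuous y₀ := continuous_iff_continuousAt.2 fun x => (hy₀ x).continuousAt
  have hK₀ : IsCompact (y₀ '' Icc 0 X) := isCompact_Icc.image hcont
  obtain ⟨d, hd, hdΩ⟩ := hK₀.exists_cthickening_subset_open hΩ (by
    rintro _ ⟨x, -, rfl⟩; exact hy₀Ω x)
  obtain ⟨Λ, hΛ⟩ := exists_lipschitzOnWith_of_isCompact hΩ hF (hK₀.cthickening (r := d)) hdΩ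
  -- The barrier must grow strictly faster than the Lipschitz constant `Λ` permits.
  set A : ℝ := Λ + 1 with hA
  have hA0 : 0 < A := by positivity
  refine ⟨min r d * Real.exp (-A * X), by positivity, fun y hy hy0 => ?_⟩
  have hB : ∀ x ∈ Icc 0 X, min r d * Real.exp (-A * X) * Real.exp (A * x) ≤ min r d := by
    intro x hx
    rw [mul_assoc, ← Real.exp_add]
    refine mul_le_of_le_one_right (by positivity) ?_
    rw [Real.exp_le_one_iff]
    nlinarith [hx.2]
  have hBd : ∀ x, HasDerivAt (fun x : ℝ => min r d * Real.exp (-A * X) * Real.exp (A * x))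
      (A * (min r d * Real.exp (-A * X) * Real.exp (A * x))) x := fun x => by
    have h1 : HasDerivAt (fun x : ℝ => A * x) A x := by
      simpa using (hasDerivAt_id x).const_mul A
    refine (h1.exp.const_mul _).congr_deriv ?_
    ring
  have key := image_norm_le_of_norm_deriv_right_lt_deriv_boundary (f := fun x => y x - y₀ x)
    (f' := fun x => F (y x) - F (y₀ x)) (a := 0) (b := X)
    (fun x _ => ((hy x).sub (hy₀ x)).continuousAt.continuousWithinAt)
    (fun x _ => ((hy x).sub (hy₀ x)).hasDerivWithinAt) (by simpa using hy0) hBd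
    (fun x hx heq => ?_)
  · exact fun x hx => (key hx).trans ((hB x hx).trans (min_le_left _ _))
  · have hx' : x ∈ Icc 0 X := ⟨hx.1, hx.2.le⟩
    have hmem₀ : y₀ x ∈ Metric.cthickening d (y₀ '' Icc 0 X) :=
      Metric.self_subset_cthickening _ (mem_image_of_mem _ hx')
    have hmem : y x ∈ Metric.cthickening d (y₀ '' Icc 0 X) := by
      refine Metric.mem_cthickening_of_dist_le _ (y₀ x) _ _ (mem_image_of_mem _ hx') ?_
      rw [dist_eq_norm, heq]
      exact (hB x hx').trans (min_le_right _ _)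
    have h1 := hΛ.dist_le_mul _ hmem _ hmem₀
    rw [dist_eq_norm, dist_eq_norm, heq] at h1
    refine h1.trans_lt (mul_lt_mul_of_pos_right ?_ (by positivity))
    linarith

/-- Negative times follow by time reversal, which replaces `F` by `-F`. -/
theorem continuous_dependence {E : Type} [NormedAddCommGroup E] [NormedSpace ℝ E]
    [ProperSpace E] {F : E → E} {Ω : Set E} (hΩ : IsOpen Ω) (hF : ContDiffOn ℝ 1 F Ω)
    {y₀ : ℝ → E} (hy₀ : ∀ x, HasDerivAt y₀ (F (y₀ x)) x) (hy₀Ω : ∀ x, y₀ x ∈ Ω) {X r : ℝ}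
    (hr : 0 < r) : ∃ η > 0, ∀ y : ℝ → E, (∀ x, HasDerivAt y (F (y x)) x) →
      ‖y 0 - y₀ 0‖ ≤ η → ∀ x ∈ Icc (-X) X, ‖y x - y₀ x‖ ≤ r := by
  have hneg : ∀ {y : ℝ → E}, (∀ x, HasDerivAt y (F (y x)) x) →
      ∀ x, HasDerivAt (fun x => y (-x)) ((fun z => -F z) (y (-x))) x := fun hy x =>
    ((hy (-x)).scomp x (hasDerivAt_neg x)).congr_deriv (by simp)
  obtain ⟨a, ha, h1⟩ := continuous_dependence_forward hΩ hF hy₀ hy₀Ω (X := X) hr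
  obtain ⟨b, hb, h2⟩ := continuous_dependence_forward hΩ hF.neg (hneg hy₀)
    (fun x => hy₀Ω (-x)) (X := X) hr
  refine ⟨min a b, lt_min ha hb, fun y hy hy0 x hx => ?_⟩
  rcases le_total 0 x with h | h
  · exact h1 y hy (hy0.trans (min_le_left _ _)) x ⟨h, hx.2⟩
  · have := h2 (fun x => y (-x)) (hneg hy) (by simpa using hy0.trans (min_le_right _ _)) (-x)
      ⟨by linarith, by linarith [hx.1]⟩
    simpa using this

/-! ### The pulse solutions stay in a compact set -/

namespace RDSystem

variable {m n : ℕ} {S : RDSystem m n}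

/-- The vector field of the stationary problem, augmented by the equation `ε' = 0`. -/
noncomputable def field (S : RDSystem m n) (y : Phase m n × ℝ) : Phase m n × ℝ :=
  ((y.2 • (S.d₁⁻¹ * y.1.2.1), y.2 • S.H₁ y.1.1 y.1.2.2.1 y.2 + S.H₂ y.1.1 y.1.2.2.1,
    S.d₂⁻¹ * y.1.2.2.2, S.G y.1.1 y.1.2.2.1 y.2), 0)

/-- The domain of the augmented vector field. -/
def fieldDomain (S : RDSystem m n) : Set (Phase m n × ℝ) :=
  {y | y.1.1 ∈ S.U ∧ y.1.2.2.1 ∈ S.V ∧ y.2 ∈ S.I}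

theorem Interaction.isOpen_fieldDomain (hS : S.Interaction) : IsOpen S.fieldDomain := by
  refine (hS.U_open.preimage (f := fun y : Phase m n × ℝ => y.1.1) (by fun_prop)).inter
    ((hS.V_open.preimage (f := fun y : Phase m n × ℝ => y.1.2.2.1) (by fun_prop)).inter
      (hS.I_open.preimage continuous_snd))

theorem Interaction.contDiffOn_field (hS : S.Interaction) :
    ContDiffOn ℝ 1 S.field S.fieldDomain := by
  have a1 : ContDiff ℝ 1 fun y : Phase m n × ℝ => (y.1.1, y.1.2.2.1, y.2) := by fun_prop
  have a2 : ContDiff ℝ 1 fun y : Phase m n × ℝ => (y.1.1, y.1.2.2.1) := by fun_prop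
  have b1 := (hS.H₁_smooth.of_le (m := 1) (by norm_num)).comp (s := S.fieldDomain)
    a1.contDiffOn (fun y hy => ⟨hy.1, hy.2.1, hy.2.2⟩)
  have b2 := (hS.G_smooth.of_le (m := 1) (by norm_num)).comp (s := S.fieldDomain)
    a1.contDiffOn (fun y hy => ⟨hy.1, hy.2.1, hy.2.2⟩)
  have b3 := (hS.H₂_smooth.of_le (m := 1) (by norm_num)).comp (s := S.fieldDomain)
    a2.contDiffOn (fun y hy => ⟨hy.1, hy.2.1⟩)
  have c1 : ContDiff ℝ 1 fun y : Phase m n × ℝ => y.2 • (S.d₁⁻¹ * y.1.2.1) := by fun_prop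
  have c2 : ContDiff ℝ 1 fun y : Phase m n × ℝ => S.d₂⁻¹ * y.1.2.2.2 := by fun_prop
  have c3 : ContDiff ℝ 1 fun y : Phase m n × ℝ => y.2 := by fun_prop
  exact (c1.contDiffOn.prodMk (((c3.contDiffOn.smul b1).add b3).prodMk
    (c2.contDiffOn.prodMk b2))).prodMk contDiffOn_const

theorem hasDerivAt_of_mul {k : ℕ} {d : Fin k → ℝ} (hd : ∀ i, 0 < d i) {f : ℝ → Fin k → ℝ}
    {f' : Fin k → ℝ} {x : ℝ} (h : HasDerivAt (fun y => d * f y) f' x) :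
    HasDerivAt f (d⁻¹ * f') x := by
  refine hasDerivAt_pi.2 fun i => ?_
  have h1 := (hasDerivAt_pi.1 h i).const_mul (d i)⁻¹
  refine (h1.congr_of_eventuallyEq (Eventually.of_forall fun y => ?_))
  simp [inv_mul_cancel_left₀ (hd i).ne']

theorem IsStationary.hasDerivAt_field (hS : S.Interaction) {ε : ℝ} {u p : ℝ → Fin m → ℝ}
    {v q : ℝ → Fin n → ℝ} (h : S.IsStationary ε u p v q) (x : ℝ) :
    HasDerivAt (fun x => (((u x, p x, v x, q x), ε) : Phase m n × ℝ))
      (S.field ((u x, p x, v x, q x), ε)) x := by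
  refine HasDerivAt.prodMk (HasDerivAt.prodMk ?_ (HasDerivAt.prodMk (h.p_eq x)
    (HasDerivAt.prodMk (hasDerivAt_of_mul hS.d₂_pos (h.v_eq x)) (h.q_eq x))))
    (hasDerivAt_const x ε)
  refine (hasDerivAt_of_mul hS.d₁_pos (h.u_eq x)).congr_deriv ?_
  simp

/-- At `ε = 0` the slow variable `u` is frozen and `p` is a primitive of `H₂ u₀ v`. This completes
the homoclinic to an orbit of the augmented field with which the pulses can be compared. -/
theorem IsHomoclinic.exists_hasDerivAt_field (hS : S.Interaction) {u₀ : Fin m → ℝ} (hu₀ : u₀ ∈ S.U)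
    {v q : ℝ → Fin n → ℝ} (h : S.IsHomoclinic u₀ v q) (p₀ : Fin m → ℝ) :
    ∃ p : ℝ → Fin m → ℝ, p 0 = p₀ ∧ ∀ x,
      HasDerivAt (fun x => (((u₀, p x, v x, q x), 0) : Phase m n × ℝ))
        (S.field ((u₀, p x, v x, q x), 0)) x := by
  have hv : ∀ x, HasDerivAt v (S.d₂⁻¹ * q x) x := fun x => hasDerivAt_of_mul hS.d₂_pos (h.v_eq x)
  have hvc : Continuous v := continuous_iff_continuousAt.2 fun x => (hv x).continuousAt
  have hc : Continuous fun x => S.H₂ u₀ (v x) :=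
    hS.H₂_smooth.continuousOn.comp_continuous (f := fun x => (u₀, v x)) (by fun_prop)
      fun x => ⟨hu₀, h.mem_V x⟩
  refine ⟨fun x => p₀ + ∫ s in (0 : ℝ)..x, S.H₂ u₀ (v s), by simp, fun x => ?_⟩
  refine HasDerivAt.prodMk (HasDerivAt.prodMk ?_ (HasDerivAt.prodMk ?_
    (HasDerivAt.prodMk (hv x) (h.q_eq x)))) (hasDerivAt_const x 0)
  · refine (hasDerivAt_const x u₀).congr_deriv ?_
    simp
  · refine ((hc.integral_hasStrictDerivAt 0 x).hasDerivAt.const_add p₀).congr_deriv ?_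
    simp

theorem IsStationary.continuous_u (hS : S.Interaction) {ε : ℝ} {u p : ℝ → Fin m → ℝ}
    {v q : ℝ → Fin n → ℝ} (h : S.IsStationary ε u p v q) : Continuous u :=
  continuous_iff_continuousAt.2 fun x => (hasDerivAt_of_mul hS.d₁_pos (h.u_eq x)).continuousAt

theorem IsStationary.continuous_v (hS : S.Interaction) {ε : ℝ} {u p : ℝ → Fin m → ℝ}
    {v q : ℝ → Fin n → ℝ} (h : S.IsStationary ε u p v q) : Continuous v :=
  continuous_iff_continuousAt.2 fun x => (hasDerivAt_of_mul hS.d₂_pos (h.v_eq x)).continuousAt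

/-- For small `ε` the `(u, v)`-components of the pulse solutions have values in a fixed compact
subset of `U × V`, and their `v`-components decay exponentially away from the pulses. -/
theorem IsPulseFamily.exists_compact (hS : S.Interaction) {ε₀ L₀ : ℝ} (hε₀ : 0 < ε₀) {L : ℝ → ℝ}
    {u p : ℝ → ℝ → Fin m → ℝ} {v q : ℝ → ℝ → Fin n → ℝ}
    (h : S.IsPulseFamily ε₀ L₀ L u p v q) :
    ∃ K : Set ((Fin m → ℝ) × (Fin n → ℝ)), IsCompact K ∧ K ⊆ S.U ×ˢ S.V ∧
      ∃ Ls βs : ℝ, 0 < Ls ∧ 0 < βs ∧ ∀ᶠ ε in 𝓝[>] 0, L₀ ≤ ε * (2 * L ε) ∧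
        (∀ x, (u ε x, v ε x) ∈ K) ∧
        ∀ x ∈ Icc 0 (2 * L ε), ‖v ε x‖ ≤ Ls * Real.exp (-βs * min x (2 * L ε - x)) := by
  obtain ⟨u₀, hu₀, p₀, vh, qh, hhom, hO⟩ := h.pulse
  obtain ⟨Ls, βs, a, b, us, ps, hLs, hβs, ha, hb, hslow, hdec⟩ := h.decay
  have hL₀ := h.L₀_pos
  have hUV : IsOpen (S.U ×ˢ S.V) := hS.U_open.prod hS.V_open
  -- `ε y` may slightly exceed `2 L₀`, since `2 ε L_ε` only converges to it; the midpoint of `2 L₀`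
  -- and `b` leaves room.
  have husc : ContinuousOn us (Icc 0 ((2 * L₀ + b) / 2)) := fun t ht =>
    (hasDerivAt_of_mul hS.d₁_pos (hslow.u_eq t ⟨by linarith [ht.1], by linarith [ht.2]⟩)
      ).continuousAt.continuousWithinAt
  have hK₂ : IsCompact ((fun t => (us t, (0 : Fin n → ℝ))) '' Icc 0 ((2 * L₀ + b) / 2)) :=
    isCompact_Icc.image_of_continuousOn (husc.prodMk continuousOn_const)
  obtain ⟨r₂, hr₂, hK₂U⟩ := hK₂.exists_cthickening_subset_open hUV (by
    rintro _ ⟨t, ht, rfl⟩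
    exact ⟨hslow.mem_U t ⟨by linarith [ht.1], by linarith [ht.2]⟩, hS.zero_mem_V⟩)
  -- At distance at least `X` from the pulses the exponential error is below the radius `r₂` of the
  -- slow tube.
  obtain ⟨X, hX⟩ : ∃ X : ℝ, Ls * Real.exp (-βs * X) ≤ r₂ := by
    have h1 : Tendsto (fun X : ℝ => Ls * Real.exp (-βs * X)) atTop (𝓝 (Ls * 0)) :=
      (Real.tendsto_exp_atBot.comp
        (tendsto_id.const_mul_atTop_of_neg (by linarith : -βs < 0))).const_mul Ls
    rw [mul_zero] at h1
    exact (h1.eventually (eventually_le_nhds hr₂)).exists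
  obtain ⟨ph, hph0, hph⟩ := hhom.exists_hasDerivAt_field hS hu₀ p₀
  have hvc : Continuous vh := continuous_iff_continuousAt.2 fun x =>
    (hasDerivAt_of_mul hS.d₂_pos (hhom.v_eq x)).continuousAt
  have hK₁ : IsCompact ((fun x => (u₀, vh x)) '' Icc (-X) X) :=
    isCompact_Icc.image (by fun_prop)
  obtain ⟨r₁, hr₁, hK₁U⟩ := hK₁.exists_cthickening_subset_open hUV (by
    rintro _ ⟨x, -, rfl⟩
    exact ⟨hu₀, hhom.mem_V x⟩)
  obtain ⟨η, hη, hdep⟩ := continuous_dependence hS.isOpen_fieldDomain hS.contDiffOn_field hph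
    (fun x => ⟨hu₀, hhom.mem_V x, hS.zero_mem_I⟩) (X := X) hr₁
  refine ⟨_, (hK₁.cthickening (r := r₁)).union (hK₂.cthickening (r := r₂)),
    union_subset hK₁U hK₂U, Ls, βs, hLs, hβs, ?_⟩
  have hid : Tendsto (fun ε : ℝ => ε) (𝓝[>] 0) (𝓝 0) := nhdsWithin_le_nhds
  have t1 := hO.trans_tendsto hid
  have t2 : ∀ᶠ ε in 𝓝[>] (0 : ℝ), ‖((u ε 0, p ε 0, v ε 0, q ε 0) : Phase m n) -
      (u₀, p₀, vh 0, qh 0)‖ < η := by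
    have := t1.norm
    rw [norm_zero] at this
    exact this.eventually (eventually_lt_nhds hη)
  have t3 := hid.eventually (eventually_lt_nhds hη)
  have t4 : ∀ᶠ ε : ℝ in 𝓝[>] 0, Ls * ε < r₂ := by
    have := hid.const_mul Ls
    rw [mul_zero] at this
    exact this.eventually (eventually_lt_nhds hr₂)
  have t5 := h.order_period.eventually (eventually_lt_nhds (show L₀ < (2 * L₀ + b) / 4 by linarith))
  have t6 := h.order_period.eventually (eventually_gt_nhds (show L₀ / 2 < L₀ by linarith))
  filter_upwards [t2, t3, t4, t5, t6, hdec, Ioo_mem_nhdsGT hε₀] with ε e2 e3 e4 e5 e6 e7 hε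
  have hst := h.stationary ε hε
  refine ⟨by linarith, ?_, ?_⟩
  · have near : ∀ x ∈ Icc (-X) X, (u ε x, v ε x) ∈
        Metric.cthickening r₁ ((fun x => (u₀, vh x)) '' Icc (-X) X) := by
      intro x hx
      have h1 := hdep _ (fun x => hst.hasDerivAt_field hS x) (by
        rw [hph0, Prod.mk_sub_mk, Prod.norm_mk, sub_zero, Real.norm_of_nonneg hε.1.le]
        exact max_le e2.le e3.le) x hx
      refine Metric.mem_cthickening_of_dist_le _ (u₀, vh x) _ _ (mem_image_of_mem _ hx) ?_
      rw [dist_eq_norm]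
      simp only [Prod.mk_sub_mk, Prod.norm_mk, max_le_iff] at h1 ⊢
      exact ⟨h1.1.1, h1.1.2.2.1⟩
    intro x
    have hper := h.periodic ε hε
    have hLε := h.L_pos ε hε
    obtain ⟨y, hy, hxy⟩ := hper.exists_mem_Ico₀ (by linarith) x
    have hu : u ε x = u ε y := congrArg (fun z => z.1) hxy
    have hv : v ε x = v ε y := congrArg (fun z => z.2.2.1) hxy
    rw [hu, hv]
    rcases lt_or_ge y X with hyX | hyX
    · exact Or.inl (near y ⟨by linarith [hy.1, hy.2], hyX.le⟩)
    -- The last stretch of a period is shifted back by one period into `[-X, 0]`, near the pulse at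
    -- `0`.
    rcases lt_or_ge (2 * L ε - y) X with hyX' | hyX'
    · have h2 := hper (y - 2 * L ε)
      rw [sub_add_cancel] at h2
      have hu : u ε y = u ε (y - 2 * L ε) := congrArg (fun z => z.1) h2
      have hv : v ε y = v ε (y - 2 * L ε) := congrArg (fun z => z.2.2.1) h2
      rw [hu, hv]
      exact Or.inl (near _ ⟨by linarith, by linarith [hy.1, hy.2]⟩)
    · refine Or.inr (Metric.mem_cthickening_of_dist_le _ (us (ε * y), 0) _ _
        (mem_image_of_mem (fun t => (us t, (0 : Fin n → ℝ)))
          (⟨mul_nonneg hε.1.le hy.1, ?_⟩ : ε * y ∈ Icc 0 ((2 * L₀ + b) / 2))) ?_)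
      · have := mul_le_mul_of_nonneg_left hy.2.le hε.1.le
        linarith
      · have h1 := (e7 y ⟨hy.1, hy.2.le⟩).2
        have h2 : Ls * max ε (Real.exp (-βs * min y (2 * L ε - y))) ≤ r₂ := by
          rw [mul_max_of_nonneg _ _ hLs.le]
          refine max_le e4.le (le_trans (mul_le_mul_of_nonneg_left ?_ hLs.le) hX)
          rw [Real.exp_le_exp]
          nlinarith [le_min hyX hyX']
        have h3 := h1.trans h2
        rw [dist_eq_norm]
        simp only [Prod.mk_sub_mk, Prod.norm_mk, max_le_iff] at h3 ⊢
        exact ⟨h3.1, h3.2.2.1⟩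
  · intro x hx
    refine le_trans ?_ (e7 x hx).1
    -- Every point of the manifold has `v = 0`, so the distance to it is at least `‖v‖`.
    have hne : S.slowManifold.Nonempty := ⟨(u₀, 0, 0, 0), hu₀, rfl, rfl⟩
    refine (Metric.le_infDist hne).2 fun y hy => ?_
    rw [dist_eq_norm]
    have h1 := (norm_snd_le (((u ε x, p ε x, v ε x, q ε x) : Phase m n) - y))
    have h2 := (norm_snd_le (((u ε x, p ε x, v ε x, q ε x) : Phase m n) - y).2)
    have h3 := (norm_fst_le (((u ε x, p ε x, v ε x, q ε x) : Phase m n) - y).2.2)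
    have h4 : (((u ε x, p ε x, v ε x, q ε x) : Phase m n) - y).2.2.1 = v ε x := by
      change v ε x - y.2.2.1 = v ε x
      rw [hy.2.1, sub_zero]
    rw [h4] at h3
    exact h3.trans (h2.trans h1)

end RDSystem

/-! ### Regularity and bounds for the linearized reaction terms -/

section Jacobian

variable {m n k : ℕ} {U : Set (Fin m → ℝ)} {V : Set (Fin n → ℝ)} {I : Set ℝ}
  {H : (Fin m → ℝ) → (Fin n → ℝ) → ℝ → (Fin k → ℝ)}

theorem jacobian_apply {k l : ℕ} (F : (Fin k → ℝ) → (Fin l → ℝ)) (w : Fin k → ℝ) (i : Fin l)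
    (j : Fin k) : jacobian F w i j = fderiv ℝ F w (Pi.single j 1) i := by
  rw [jacobian, LinearMap.toMatrix'_apply]
  rfl

theorem contDiffOn_fderiv_apply {E : Type} [NormedAddCommGroup E] [NormedSpace ℝ E]
    {f : E → Fin k → ℝ} {Ω : Set E} (hΩ : IsOpen Ω) (hf : ContDiffOn ℝ 2 f Ω) (e : E)
    (i : Fin k) : ContDiffOn ℝ 1 (fun y => fderiv ℝ f y e i) Ω :=
  contDiffOn_pi.1 ((hf.fderiv_of_isOpen hΩ (m := 1) (by norm_num)).clm_apply
    contDiffOn_const) i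

/-- A partial derivative is the full derivative in a fixed direction, hence jointly `C¹` in `(u, v,
ε)` and not only in the variable differentiated. -/
theorem contDiffOn_jacobian_fst (hU : IsOpen U) (hV : IsOpen V) (hI : IsOpen I)
    (hH : ContDiffOn ℝ 2 (fun y : (Fin m → ℝ) × (Fin n → ℝ) × ℝ => H y.1 y.2.1 y.2.2)
      (U ×ˢ V ×ˢ I)) (i : Fin k) (j : Fin m) :
    ContDiffOn ℝ 1 (fun y : (Fin m → ℝ) × (Fin n → ℝ) × ℝ =>
      jacobian (fun u' => H u' y.2.1 y.2.2) y.1 i j) (U ×ˢ V ×ˢ I) := by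
  have hΩ : IsOpen (U ×ˢ V ×ˢ I) := hU.prod (hV.prod hI)
  refine (contDiffOn_fderiv_apply hΩ hH (Pi.single j 1, 0, 0) i).congr fun y hy => ?_
  rw [jacobian_apply]
  have h1 := ((hH.contDiffAt (hΩ.mem_nhds hy)).differentiableAt (by norm_num)).hasFDerivAt
  have h2 := h1.comp (f := fun u' => (u', y.2.1, y.2.2)) y.1 ((hasFDerivAt_id y.1).prodMk
    (hasFDerivAt_const (y.2.1, y.2.2) y.1))
  have h3 : fderiv ℝ (fun u' => H u' y.2.1 y.2.2) y.1 = _ := h2.fderiv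
  rw [h3]
  rfl

theorem contDiffOn_jacobian_snd (hU : IsOpen U) (hV : IsOpen V) (hI : IsOpen I)
    (hH : ContDiffOn ℝ 2 (fun y : (Fin m → ℝ) × (Fin n → ℝ) × ℝ => H y.1 y.2.1 y.2.2)
      (U ×ˢ V ×ˢ I)) (i : Fin k) (j : Fin n) :
    ContDiffOn ℝ 1 (fun y : (Fin m → ℝ) × (Fin n → ℝ) × ℝ =>
      jacobian (fun v' => H y.1 v' y.2.2) y.2.1 i j) (U ×ˢ V ×ˢ I) := by
  have hΩ : IsOpen (U ×ˢ V ×ˢ I) := hU.prod (hV.prod hI)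
  refine (contDiffOn_fderiv_apply hΩ hH (0, Pi.single j 1, 0) i).congr fun y hy => ?_
  rw [jacobian_apply]
  have h1 := ((hH.contDiffAt (hΩ.mem_nhds hy)).differentiableAt (by norm_num)).hasFDerivAt
  have h2 := h1.comp (f := fun v' => (y.1, v', y.2.2)) y.2.1 ((hasFDerivAt_const y.1 y.2.1).prodMk
    ((hasFDerivAt_id y.2.1).prodMk (hasFDerivAt_const y.2.2 y.2.1)))
  have h3 : fderiv ℝ (fun v' => H y.1 v' y.2.2) y.2.1 = _ := h2.fderiv
  rw [h3]
  rfl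

variable {Q : Set ((Fin m → ℝ) × (Fin n → ℝ) × ℝ)}

theorem exists_uniform_bound {X : Type} {a b : ℕ} {φ : Fin a → Fin b → X → ℝ} {g : X → ℝ}
    {s : Set X} (hg : ∀ x ∈ s, 0 ≤ g x)
    (h : ∀ i j, ∃ C, ∀ x ∈ s, |φ i j x| ≤ C * g x) :
    ∃ C, 0 ≤ C ∧ ∀ x ∈ s, ∀ i j, |φ i j x| ≤ C * g x := by
  choose C hC using h
  refine ⟨∑ i, ∑ j, |C i j|, by positivity, fun x hx i j => (hC i j x hx).trans ?_⟩
  refine mul_le_mul_of_nonneg_right ?_ (hg x hx)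
  calc C i j ≤ |C i j| := le_abs_self _
    _ ≤ ∑ j, |C i j| :=
      Finset.single_le_sum (f := fun j => |C i j|) (fun _ _ => abs_nonneg _) (Finset.mem_univ j)
    _ ≤ ∑ i, ∑ j, |C i j| := Finset.single_le_sum (f := fun i => ∑ j, |C i j|)
      (fun _ _ => Finset.sum_nonneg fun _ _ => abs_nonneg _) (Finset.mem_univ i)

theorem exists_jacobian_fst_bound (hU : IsOpen U) (hV : IsOpen V) (hI : IsOpen I)
    (hH : ContDiffOn ℝ 2 (fun y : (Fin m → ℝ) × (Fin n → ℝ) × ℝ => H y.1 y.2.1 y.2.2)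
      (U ×ˢ V ×ˢ I)) (hQ : IsCompact Q) (hQs : Q ⊆ U ×ˢ V ×ˢ I) :
    ∃ C, 0 ≤ C ∧ ∀ y ∈ Q, ∀ i j,
      |jacobian (fun u' => H u' y.2.1 y.2.2) y.1 i j| ≤ C * 1 := by
  refine exists_uniform_bound (g := fun _ => 1)
    (φ := fun i j (y : (Fin m → ℝ) × (Fin n → ℝ) × ℝ) =>
      jacobian (fun u' => H u' y.2.1 y.2.2) y.1 i j) (fun _ _ => zero_le_one)
    fun i j => ?_
  obtain ⟨C, hC⟩ := hQ.exists_bound_of_continuousOn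
    ((contDiffOn_jacobian_fst hU hV hI hH i j).continuousOn.mono hQs)
  exact ⟨C, fun y hy => (hC y hy).trans_eq (mul_one C).symm⟩

theorem exists_jacobian_snd_bound (hU : IsOpen U) (hV : IsOpen V) (hI : IsOpen I)
    (hH : ContDiffOn ℝ 2 (fun y : (Fin m → ℝ) × (Fin n → ℝ) × ℝ => H y.1 y.2.1 y.2.2)
      (U ×ˢ V ×ˢ I)) (hQ : IsCompact Q) (hQs : Q ⊆ U ×ˢ V ×ˢ I) :
    ∃ C, 0 ≤ C ∧ ∀ y ∈ Q, ∀ i j,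
      |jacobian (fun v' => H y.1 v' y.2.2) y.2.1 i j| ≤ C * 1 := by
  refine exists_uniform_bound (g := fun _ => 1)
    (φ := fun i j (y : (Fin m → ℝ) × (Fin n → ℝ) × ℝ) =>
      jacobian (fun v' => H y.1 v' y.2.2) y.2.1 i j) (fun _ _ => zero_le_one)
    fun i j => ?_
  obtain ⟨C, hC⟩ := hQ.exists_bound_of_continuousOn
    ((contDiffOn_jacobian_snd hU hV hI hH i j).continuousOn.mono hQs)
  exact ⟨C, fun y hy => (hC y hy).trans_eq (mul_one C).symm⟩

/-- If `H` vanishes at `v = 0`, then `∂ᵤ H = O(|v|)` on compact sets. -/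
theorem exists_jacobian_fst_bound_of_zero (hU : IsOpen U) (hV : IsOpen V) (hI : IsOpen I)
    (hH : ContDiffOn ℝ 2 (fun y : (Fin m → ℝ) × (Fin n → ℝ) × ℝ => H y.1 y.2.1 y.2.2)
      (U ×ˢ V ×ˢ I)) (h0 : (0 : Fin n → ℝ) ∈ V) (hH0 : ∀ u ∈ U, ∀ ε ∈ I, H u 0 ε = 0)
    (hQ : IsCompact Q) (hQs : Q ⊆ U ×ˢ V ×ˢ I) :
    ∃ C, 0 ≤ C ∧ ∀ y ∈ Q, ∀ i j,
      |jacobian (fun u' => H u' y.2.1 y.2.2) y.1 i j| ≤ C * ‖y.2.1‖ := by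
  refine exists_uniform_bound (g := fun (y : (Fin m → ℝ) × (Fin n → ℝ) × ℝ) => ‖y.2.1‖)
    (φ := fun i j (y : (Fin m → ℝ) × (Fin n → ℝ) × ℝ) =>
      jacobian (fun u' => H u' y.2.1 y.2.2) y.1 i j) (fun _ _ => norm_nonneg _)
    fun i j => ?_
  set π₀ : (Fin m → ℝ) × (Fin n → ℝ) × ℝ → (Fin m → ℝ) × (Fin n → ℝ) × ℝ :=
    fun y => (y.1, 0, y.2.2) with hπ₀
  -- Adjoining the projection of `Q` to `v = 0` gives one compact set, hence one Lipschitz constant,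
  -- containing both points to be compared.
  have hQ' : IsCompact (Q ∪ π₀ '' Q) := hQ.union (hQ.image (by fun_prop))
  have hQ's : Q ∪ π₀ '' Q ⊆ U ×ˢ V ×ˢ I := by
    refine union_subset hQs ?_
    rintro _ ⟨y, hy, rfl⟩
    exact ⟨(hQs hy).1, h0, (hQs hy).2.2⟩
  obtain ⟨C, hC⟩ := exists_lipschitzOnWith_of_isCompact (hU.prod (hV.prod hI))
    (contDiffOn_jacobian_fst hU hV hI hH i j) hQ' hQ's
  refine ⟨C, fun y hy => ?_⟩
  have h1 := hC.dist_le_mul y (Or.inl hy) (π₀ y) (Or.inr (mem_image_of_mem _ hy))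
  have h2 : jacobian (fun u' => H u' 0 y.2.2) y.1 i j = 0 := by
    have h3 : (fun u' => H u' 0 y.2.2) =ᶠ[𝓝 y.1] fun _ => 0 := by
      filter_upwards [hU.mem_nhds (hQs hy).1] with u' hu'
      exact hH0 u' hu' _ (hQs hy).2.2
    rw [jacobian_apply, h3.fderiv_eq, fderiv_fun_const]
    simp
  have h3 : dist y (π₀ y) = ‖y.2.1‖ := by
    rw [dist_eq_norm]
    simp [hπ₀, Prod.norm_def]
  rw [h3, Real.dist_eq] at h1
  simp only [hπ₀] at h1
  rwa [h2, sub_zero] at h1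

end Jacobian

/-- The function descends to the circle, where compactness gives both properties. -/
theorem isCub_of_periodic {f : ℝ → ℝ} (hf : Continuous f) {c : ℝ} (hc : 0 < c)
    (hper : Function.Periodic f c) : IsCub f := by
  have : Fact (0 < c) := ⟨hc⟩
  have h1 : Continuous (hper.lift : AddCircle c → ℝ) := continuous_coinduced_dom.2 hf
  have h2 : UniformContinuous (hper.lift : AddCircle c → ℝ) :=
    CompactSpace.uniformContinuous_of_continuous h1
  have h3 : UniformContinuous fun x : ℝ => (x : AddCircle c) := by
    refine (LipschitzWith.of_dist_le_mul (K := 1) fun x y => ?_).uniformContinuous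
    rw [dist_eq_norm, dist_eq_norm, ← AddCircle.coe_sub, NNReal.coe_one, one_mul]
    exact norm_coe_addCircle_le _
  refine ⟨h2.comp h3, ?_⟩
  obtain ⟨C, hC⟩ := isCompact_univ.exists_bound_of_continuousOn h1.continuousOn
  exact ⟨C, fun x => hC (x : AddCircle c) (mem_univ _)⟩

/-! ### The linearization about a pulse satisfies the localized coefficient bounds -/

namespace RDSystem

variable {m n : ℕ} {S : RDSystem m n}

theorem Interaction.contDiffOn_H₂ (hS : S.Interaction) :
    ContDiffOn ℝ 2 (fun y : (Fin m → ℝ) × (Fin n → ℝ) × ℝ => S.H₂ y.1 y.2.1)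
      (S.U ×ˢ S.V ×ˢ S.I) := by
  have a : ContDiff ℝ 2 fun y : (Fin m → ℝ) × (Fin n → ℝ) × ℝ => (y.1, y.2.1) := by fun_prop
  exact hS.H₂_smooth.comp a.contDiffOn fun y hy => ⟨hy.1, hy.2.1⟩

theorem isCub_reactionMatrix (hS : S.Interaction) {ε₀ L₀ : ℝ} {L : ℝ → ℝ}
    {u p : ℝ → ℝ → Fin m → ℝ} {v q : ℝ → ℝ → Fin n → ℝ} (h : S.IsPulseFamily ε₀ L₀ L u p v q)
    {ε : ℝ} (hε : ε ∈ Ioo 0 ε₀) (i j : Fin m ⊕ Fin n) :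
    IsCub fun ξ => S.reactionMatrix ε (u ε (ε⁻¹ * ξ)) (v ε (ε⁻¹ * ξ)) i j := by
  have hst := h.stationary ε hε
  have hεI := h.subset_I hε
  have hL := h.L_pos ε hε
  have hε0 : 0 < ε := hε.1
  have hu := hst.continuous_u hS
  have hv := hst.continuous_v hS
  have hc : Continuous fun ξ : ℝ => (u ε (ε⁻¹ * ξ), v ε (ε⁻¹ * ξ), ε) := by fun_prop
  have hmem : ∀ ξ : ℝ, (u ε (ε⁻¹ * ξ), v ε (ε⁻¹ * ξ), ε) ∈ S.U ×ˢ S.V ×ˢ S.I := fun ξ =>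
    ⟨hst.mem_U _, hst.mem_V _, hεI⟩
  refine isCub_of_periodic ?_ (c := ε * (2 * L ε)) (by positivity) fun ξ => ?_
  · have c1 := fun i j => (contDiffOn_jacobian_fst hS.U_open hS.V_open hS.I_open hS.H₁_smooth
      i j).continuousOn.comp_continuous hc hmem
    have c2 := fun i j => (contDiffOn_jacobian_snd hS.U_open hS.V_open hS.I_open hS.H₁_smooth
      i j).continuousOn.comp_continuous hc hmem
    have c3 := fun i j => (contDiffOn_jacobian_fst (H := fun u v _ => S.H₂ u v) hS.U_open hS.V_open
      hS.I_open hS.contDiffOn_H₂ i j).continuousOn.comp_continuous hc hmem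
    have c4 := fun i j => (contDiffOn_jacobian_snd (H := fun u v _ => S.H₂ u v) hS.U_open hS.V_open
      hS.I_open hS.contDiffOn_H₂ i j).continuousOn.comp_continuous hc hmem
    have c5 := fun i j => (contDiffOn_jacobian_fst hS.U_open hS.V_open hS.I_open hS.G_smooth
      i j).continuousOn.comp_continuous hc hmem
    have c6 := fun i j => (contDiffOn_jacobian_snd hS.U_open hS.V_open hS.I_open hS.G_smooth
      i j).continuousOn.comp_continuous hc hmem
    rcases i with i | i <;> rcases j with j | j
    · exact (c1 i j).add ((c3 i j).const_smul ε⁻¹)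
    · exact (c2 i j).add ((c4 i j).const_smul ε⁻¹)
    · exact c5 i j
    · exact c6 i j
  · have hper := h.periodic ε hε (ε⁻¹ * ξ)
    have e : ε⁻¹ * (ξ + ε * (2 * L ε)) = ε⁻¹ * ξ + 2 * L ε := by field_simp
    have eu : u ε (ε⁻¹ * ξ + 2 * L ε) = u ε (ε⁻¹ * ξ) := congrArg (fun z => z.1) hper
    have ev : v ε (ε⁻¹ * ξ + 2 * L ε) = v ε (ε⁻¹ * ξ) := congrArg (fun z => z.2.2.1) hper
    simp only [e, eu, ev]

/-- The rescaling `ξ = ε x` turns the decay rate `βs` into `βs / ε`; periodicity of both sides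
extends the estimate from one period to the line. -/
theorem norm_v_le_periodicWeight {v : ℝ → Fin n → ℝ} {Ls βs L ε : ℝ} (hLs : 0 ≤ Ls)
    (hβs : 0 ≤ βs) (hL : 0 < L) (hε : 0 < ε) (hper : Function.Periodic v (2 * L))
    (hv : ∀ x ∈ Icc 0 (2 * L), ‖v x‖ ≤ Ls * Real.exp (-βs * min x (2 * L - x))) (ξ : ℝ) :
    ‖v (ε⁻¹ * ξ)‖ ≤ Ls * periodicWeight (βs / ε) (ε * (2 * L)) ξ := by
  have hper' : Function.Periodic (fun ξ => ‖v (ε⁻¹ * ξ)‖ -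
      Ls * periodicWeight (βs / ε) (ε * (2 * L)) ξ) (ε * (2 * L)) := fun ξ => by
    have e : ε⁻¹ * (ξ + ε * (2 * L)) = ε⁻¹ * ξ + 2 * L := by field_simp
    simp only [e, hper _, periodic_periodicWeight ξ]
  obtain ⟨y, hy, hxy⟩ := hper'.exists_mem_Ico₀ (by positivity) ξ
  rw [← sub_nonpos]
  refine hxy.trans_le (sub_nonpos.2 ?_)
  have hy0 : 0 ≤ ε⁻¹ * y := mul_nonneg (by positivity) hy.1
  have hy1 : ε⁻¹ * y ≤ 2 * L := by
    rw [inv_mul_le_iff₀ hε]; exact hy.2.le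
  refine (hv _ ⟨hy0, hy1⟩).trans (mul_le_mul_of_nonneg_left ?_ hLs)
  refine le_trans (le_of_eq ?_) (le_periodicWeight (by positivity) hy.1 hy.2.le)
  have e : min (ε⁻¹ * y) (2 * L - ε⁻¹ * y) = ε⁻¹ * min y (ε * (2 * L) - y) := by
    rw [mul_min_of_nonneg _ _ (by positivity)]
    congr 1
    field_simp
  rw [e]
  congr 1
  ring

/-- The derivatives `∂ᵤ H₂` and `∂ᵤ G` are `O(|v|)` on the compact set visited by the pulses, hence
bounded by the periodic weight. The other derivatives are merely bounded. -/
theorem exists_uniform_sector (hS : S.Interaction) {ε₀ L₀ : ℝ} (hε₀ : 0 < ε₀) {L : ℝ → ℝ}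
    {u p : ℝ → ℝ → Fin m → ℝ} {v q : ℝ → ℝ → Fin n → ℝ} (h : S.IsPulseFamily ε₀ L₀ L u p v q) :
    ∃ ω : ℝ, 0 < ω ∧ ∀ᶠ ε in 𝓝[>] (0 : ℝ), sector ω (2 * Real.pi / 3) ⊆
      resolventSet (X := Cub ℂ m n) (S.linearization ℂ ε (u ε) (v ε)) := by
  obtain ⟨K, hK, hKUV, Ls, βs, hLs, hβs, hev⟩ := h.exists_compact hS hε₀
  have hUo := hS.U_open
  have hVo := hS.V_open
  have hIo := hS.I_open
  -- The closed parameter interval `[0, ε₀/2]` lies in `I`, so the constants obtained on `Q` hold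
  -- down to `ε = 0`.
  set Q : Set ((Fin m → ℝ) × (Fin n → ℝ) × ℝ) :=
    (fun y : ((Fin m → ℝ) × (Fin n → ℝ)) × ℝ => (y.1.1, y.1.2, y.2)) '' (K ×ˢ Icc 0 (ε₀ / 2))
    with hQdef
  have hQ : IsCompact Q := (hK.prod isCompact_Icc).image (by fun_prop)
  have hQs : Q ⊆ S.U ×ˢ S.V ×ˢ S.I := by
    rintro _ ⟨⟨y, e⟩, ⟨hy, he⟩, rfl⟩
    refine ⟨(hKUV hy).1, (hKUV hy).2, ?_⟩
    rcases eq_or_lt_of_le he.1 with h0 | h0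
    · rw [← h0]; exact hS.zero_mem_I
    · exact h.subset_I ⟨h0, by linarith [he.2]⟩
  have hz : ∀ u ∈ S.U, ∀ ε ∈ S.I, (fun u v _ => S.H₂ u v) u (0 : Fin n → ℝ) ε = 0 :=
    fun u hu _ _ => hS.H₂_zero u hu
  obtain ⟨C₁, p₁, b₁⟩ := exists_jacobian_fst_bound hUo hVo hIo hS.H₁_smooth hQ hQs
  obtain ⟨C₂, p₂, b₂⟩ := exists_jacobian_snd_bound hUo hVo hIo hS.H₁_smooth hQ hQs
  obtain ⟨C₃, p₃, b₃⟩ := exists_jacobian_fst_bound_of_zero (H := fun u v _ => S.H₂ u v) hUo hVo hIo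
    hS.contDiffOn_H₂ hS.zero_mem_V hz hQ hQs
  obtain ⟨C₄, p₄, b₄⟩ := exists_jacobian_snd_bound (H := fun u v _ => S.H₂ u v) hUo hVo hIo
    hS.contDiffOn_H₂ hQ hQs
  obtain ⟨C₅, p₅, b₅⟩ := exists_jacobian_fst_bound_of_zero hUo hVo hIo hS.G_smooth hS.zero_mem_V
    hS.G_zero hQ hQs
  obtain ⟨C₆, p₆, b₆⟩ := exists_jacobian_snd_bound hUo hVo hIo hS.G_smooth hQ hQs
  set C : ℝ := C₁ + C₂ + C₃ * Ls + C₄ + C₅ * Ls + C₆ with hC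
  have hs3 : 0 ≤ C₃ * Ls := by positivity
  have hs5 : 0 ≤ C₅ * Ls := by positivity
  obtain ⟨ω, hω, hsec⟩ := exists_sector_subset_resolventSet hS.d₁_pos hS.d₂_pos (C := C)
    (by positivity) hβs h.L₀_pos
  refine ⟨ω, hω, ?_⟩
  have hmin : 0 < min (ε₀ / 2) 1 := lt_min (by linarith) one_pos
  filter_upwards [hev, Ioo_mem_nhdsGT hmin] with ε hεK hε
  obtain ⟨hP, hmemK, hdecay⟩ := hεK
  have hε0 : 0 < ε := hε.1
  have hε1 : ε < 1 := hε.2.trans_le (min_le_right _ _)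
  have hε2 : ε < ε₀ / 2 := hε.2.trans_le (min_le_left _ _)
  have hεmem : ε ∈ Ioo 0 ε₀ := ⟨hε0, by linarith⟩
  have hy : ∀ ξ : ℝ, (u ε (ε⁻¹ * ξ), v ε (ε⁻¹ * ξ), ε) ∈ Q := fun ξ =>
    ⟨((u ε (ε⁻¹ * ξ), v ε (ε⁻¹ * ξ)), ε), ⟨hmemK _, hε0.le, hε2.le⟩, rfl⟩
  have hperv : Function.Periodic (v ε) (2 * L ε) := fun x =>
    congrArg (fun z => z.2.2.1) (h.periodic ε hεmem x)
  have hvw := norm_v_le_periodicWeight hLs.le hβs.le (h.L_pos ε hεmem) hε0 hperv hdecay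
  have hinv : 1 ≤ ε⁻¹ := (one_le_inv₀ hε0).2 hε1.le
  refine hsec ε (ε * (2 * L ε)) _ hε0 hε1.le hP (isCub_reactionMatrix hS h hεmem) ?_ ?_ ?_ ?_
  · intro ξ i j
    have w0 := periodicWeight_pos (b := βs / ε) (P := ε * (2 * L ε)) ξ
    have h1 := b₁ _ (hy ξ) i j
    have h2 := (b₃ _ (hy ξ) i j).trans (mul_le_mul_of_nonneg_left (hvw ξ) p₃)
    refine (abs_add_le _ _).trans ?_
    rw [Matrix.smul_apply, smul_eq_mul, abs_mul, abs_of_pos (by positivity : 0 < ε⁻¹)]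
    have h3 := mul_le_mul_of_nonneg_left h2 (by positivity : 0 ≤ ε⁻¹)
    have h4 : C₃ * Ls * (ε⁻¹ * periodicWeight (βs / ε) (ε * (2 * L ε)) ξ) ≤
        C * (ε⁻¹ * periodicWeight (βs / ε) (ε * (2 * L ε)) ξ) :=
      mul_le_mul_of_nonneg_right (by linarith) (by positivity)
    simp only at h1 h3
    linarith
  · intro ξ i j
    have h1 := b₂ _ (hy ξ) i j
    have h2 := b₄ _ (hy ξ) i j
    refine (abs_add_le _ _).trans ?_
    rw [Matrix.smul_apply, smul_eq_mul, abs_mul, abs_of_pos (by positivity : 0 < ε⁻¹)]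
    have h3 := mul_le_mul_of_nonneg_left h2 (by positivity : 0 ≤ ε⁻¹)
    have h4 : (C₂ + C₄) * ε⁻¹ ≤ C * ε⁻¹ :=
      mul_le_mul_of_nonneg_right (by linarith) (by positivity)
    have h5 : C₂ ≤ C₂ * ε⁻¹ := le_mul_of_one_le_right p₂ hinv
    simp only at h1 h3
    linarith
  · intro ξ i j
    have w0 := periodicWeight_pos (b := βs / ε) (P := ε * (2 * L ε)) ξ
    refine ((b₅ _ (hy ξ) i j).trans (mul_le_mul_of_nonneg_left (hvw ξ) p₅)).trans ?_
    rw [← mul_assoc]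
    exact mul_le_mul_of_nonneg_right (by linarith) w0.le
  · intro ξ i j
    exact (b₆ _ (hy ξ) i j).trans (by linarith)

end RDSystem

end PulseSpectrum

theorem mainTheorem12 (m n : ℕ) (hm : 0 < m) (hn : 0 < n) (S : PulseSpectrum.RDSystem m n)
    (hS1 : S.Interaction) (hS2 : S.NormallyHyperbolic)
    (ε₀ : ℝ) (hε₀ : 0 < ε₀) (L₀ : ℝ) (L : ℝ → ℝ)
    (u p : ℝ → ℝ → Fin m → ℝ) (v q : ℝ → ℝ → Fin n → ℝ)
    (hS3 : S.IsPulseFamily ε₀ L₀ L u p v q) :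
    (∀ ε ∈ Set.Ioo 0 ε₀,
      (S.linearization ℝ ε (u ε) (v ε)).domain = PulseSpectrum.C2ub ℝ m n ∧
      (S.linearization ℂ ε (u ε) (v ε)).domain = PulseSpectrum.C2ub ℂ m n ∧
      Dense ((S.linearization ℝ ε (u ε) (v ε)).domain : Set (PulseSpectrum.Cub ℝ m n)) ∧
      Dense ((S.linearization ℂ ε (u ε) (v ε)).domain : Set (PulseSpectrum.Cub ℂ m n)) ∧
      PulseSpectrum.IsSectorial (X := PulseSpectrum.Cub ℂ m n) (S.linearization ℂ ε (u ε) (v ε))) ∧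
    ∃ ω ϖ ε₁ : ℝ, 0 < ω ∧ Real.pi / 2 < ϖ ∧ ϖ < Real.pi ∧ 0 < ε₁ ∧ ε₁ ≤ ε₀ ∧
      ∀ ε ∈ Set.Ioo 0 ε₁,
        PulseSpectrum.sector ω ϖ ⊆
          PulseSpectrum.resolventSet (X := PulseSpectrum.Cub ℂ m n)
            (S.linearization ℂ ε (u ε) (v ε)) := by
  refine ⟨fun ε hε => ?_, ?_⟩
  · have hB := PulseSpectrum.RDSystem.isCub_reactionMatrix hS1 hS3 hε
    have hδ : ∀ i, 0 < Sum.elim S.d₁ (fun i => ε ^ 2 * S.d₂ i) i := by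
      rintro (i | i)
      · exact hS1.d₁_pos i
      · exact mul_pos (pow_pos hε.1 2) (hS1.d₂_pos i)
    have dR : (S.linearization ℝ ε (u ε) (v ε)).domain = PulseSpectrum.C2ub ℝ m n :=
      PulseSpectrum.diffOp_domain _ hB
    have dC : (S.linearization ℂ ε (u ε) (v ε)).domain = PulseSpectrum.C2ub ℂ m n :=
      PulseSpectrum.diffOp_domain _ hB
    refine ⟨dR, dC, ?_, ?_, PulseSpectrum.isSectorial_diffOp hδ hB⟩
    · rw [dR]; exact PulseSpectrum.dense_C2ub ℝ m n
    · rw [dC]; exact PulseSpectrum.dense_C2ub ℂ m n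
  · obtain ⟨ω, hω, hev⟩ := PulseSpectrum.RDSystem.exists_uniform_sector hS1 hε₀ hS3
    obtain ⟨ε₁, hε₁, hsub⟩ := mem_nhdsGT_iff_exists_Ioo_subset.1 hev
    have hpi := Real.pi_pos
    -- The half-angle `2π/3` is where `|κ| ≤ 2 Re κ` was available; the minimum with `ε₀` keeps `ε`
    -- in the range of the family.
    exact ⟨ω, 2 * Real.pi / 3, min ε₁ ε₀, hω, by linarith, by linarith, lt_min hε₁ hε₀,
      min_le_right _ _, fun ε hε => hsub ⟨hε.1, hε.2.trans_le (min_le_left _ _)⟩⟩
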